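/- Let $F=k((\pi))$ with $k$ a finite field of cardinality $q$, let $\bar k$ be an algebraic closure of $k$, and let $h\ge 1$. Let $\mathscr F^{\rm univ}$ be the universal deformation of the one-dimensional formal $\mathcal O_F$-module of height $h$ over $\bar k$; it lives over $\mathcal A=\bar k[[\pi]][[u_1,\dots,u_{h-1}]]$, its addition is $X+Y$, each $\zeta\in k$ acts by $\zeta X$, and $$[\pi]_{\mathscr F^{\rm univ}}(X)=\pi X+u_1X^q+\dots+u_{h-1}X^{q^{h-1}}+X^{q^h}.$$ Let $\mathcal A(\pi)$ be the finite $\mathcal A$-algebra classifying deformations with Drinfeld level $\pi$ structure, let $X_1^{(1)},\dots,X_h^{(1)}\in\mathcal A(\pi)$ be the universal Drinfeld basis of $\mathscr F^{\rm univ}[\pi]$, and let $\mathfrak X(\pi)\to\mathfrak X(1)$ be the map of rigid generic fibres of $\mathcal A(\pi)$ and $\mathcal A$. Let $\mathscr F_0$ be the specialization of $\mathscr F^{\rm univ}$ at the point $x^{(0)}=(u_1=\dots=u_{h-1}=0)$ of $\mathfrak X(1)$, so that $[\pi]_{\mathscr F_0}(X)=\pi X+X^{q^h}$, and let $E_1$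 be the field obtained from $\bar k((\pi))$ by adjoining the roots of $[\pi]_{\mathscr F_0}$; these roots form the $h$-dimensional $k$-vector space $\mathscr F_0[\pi]$. Let $v$ be the valuation with $v(\pi)=1$. Let $\mathfrak X(1)^1\subset\mathfrak X(1)$ be the affinoid $v(u_i)\ge 1$ $(1\le i\le h-1)$, and put $V_i=\pi^{-1}u_i$, so that the ring of analytic functions on $\mathfrak X(1)^1\otimes E_1$ is $E_1\langle V_1,\dots,V_{h-1}\rangle$. **Proposition 4.1.** The preimage of $\mathfrak X(1)^1\otimes E_1$ in $\mathfrak X(\pi)\otimes E_1$ is a disjoint union of closed unit polydiscs $\mathfrak X(\pi)^{1,x}$ over $E_1$ with coordinates $V_1,\dots,V_{h-1}$, indexed by the ordered $k$-bases $x=(x_1,\dots,x_h)$ of $\mathscr F_0[\pi]$. Each $\mathfrak X(\pi)^{1,x}$ contains exactly one point lying above $x^{(0)}$, namely the (unramified canonical) point where $X_r^{(1)}=x_r$ for $r=1,\dots,h$. Moreover, for every such $x$ and every $r=1,\dots,h$, in the ring $\mathcal O_{E_1}\langle V_1,\dots,V_{h-1}\rangle$ of integral analytic functions on $\mathfrak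 X(\pi)^{1,x}$, $$X_r^{(1)}\equiv (-1)^{h-1}\det \begin{pmatrix} V_1 & V_2 &\cdots & V_{h-1} & x_r\\ 1 & V_1^q &\cdots & V_{h-2}^q & x_r^q +\pi x_rV_{h-1}^q\\ 0 & 1 & \cdots & V_{h-3}^{q^2} & x_r^{q^2} +\pi x_rV_{h-2}^{q^2}\\ \vdots & & \ddots & &\vdots \\ 0 & 0 &\cdots & 1& x_r^{q^{h-1}}+\pi x_rV_1^{q^{h-1}} \end{pmatrix}\pmod{\pi^{\,q-1+\frac{q}{q^h-1}}}$$ (an $h\times h$ determinant, equal to $x_r$ when $h=1$), where a congruence modulo $\pi^\alpha$ means that the difference is an element of $E_1$ of valuation $\alpha$ times an integral function. -/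

import Mathlib

open Polynomial TensorProduct

noncomputable section

namespace LubinTate

/-! ### The universal deformation in equal characteristic

`k` is the residue field of `F = k((π))`, `q = #k`, and `κ` is an algebraic closure of `k`.  The
ring of integers of the completed maximal unramified extension of `F` is `κ⟦π⟧` (`PowerSeries κ`,
with `π = PowerSeries.X`). -/

/-- The polynomial `ϖ T + u₁ T^q + ⋯ + u_{h-1} T^{q^{h-1}} + T^{q^h}`; the variable `u_{i+1}` is
indexed by `i : Fin (h - 1)`. -/
def piPoly {R : Type*} [CommRing R] (q h : ℕ) (ϖ : R) (u : Fin (h - 1) → R) : R[X] :=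
  C ϖ * X + ∑ i, C (u i) * X ^ q ^ (i.val + 1) + X ^ q ^ h

/-- The ring `𝒜 = κ⟦π⟧⟦u₁, …, u_{h-1}⟧` of the universal deformation of the formal `𝒪_F`-module of
height `h` over `κ`.  Its rigid generic fibre `𝔛(1)` is the open unit polydisc. -/
abbrev DefRing (κ : Type*) [Field κ] (h : ℕ) : Type _ :=
  MvPowerSeries (Fin (h - 1)) (PowerSeries κ)

/-- Multiplication by `π` in the universal deformation `𝓕^univ` over `𝒜`.  (In `𝓕^univ` the addition
is `X + Y` and `ζ ∈ k` acts by `ζ X`.) -/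
def univPi (k κ : Type*) [Field k] [Fintype k] [Field κ] (h : ℕ) : (DefRing κ h)[X] :=
  piPoly (Fintype.card k) h (MvPowerSeries.C PowerSeries.X) (fun i => MvPowerSeries.X i)

/-- The polynomial `∏_{a ∈ k^h} (T - (a₁ x₁ + ⋯ + a_h x_h))`. -/
def levelPoly (k : Type*) [Field k] [Fintype k] {R : Type*} [CommRing R] [Algebra k R] {h : ℕ}
    (x : Fin h → R) : R[X] :=
  ∏ a : Fin h → k, (X - C (∑ r, a r • x r))

/-- `x₁, …, x_h` is a Drinfeld basis of `𝓕^univ[π]` over the local `𝒜`-algebra `R`: the `k`-linear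
map `k^h = (π⁻¹𝒪_F/𝒪_F)^h → R` sending the standard basis to the `x_r` takes values in the maximal
ideal, and `∏_{a ∈ k^h} (T - φ(a))` divides `[π](T)` in `R⟦T⟧`. -/
def IsDrinfeldBasis (k κ : Type*) [Field k] [Fintype k] [Field κ] {h : ℕ} {R : Type*} [CommRing R]
    [IsLocalRing R] [Algebra k R] [Algebra (DefRing κ h) R] (x : Fin h → R) : Prop :=
  (∀ r, x r ∈ IsLocalRing.maximalIdeal R) ∧
    ((levelPoly k x : R[X]) : PowerSeries R) ∣
      (((univPi k κ h).map (algebraMap (DefRing κ h) R) : R[X]) : PowerSeries R)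

/-- The relations `∏_{a ∈ k^h} (T - (a₁ X₁ + ⋯ + a_h X_h)) = [π](T)`, coefficient by coefficient. -/
def levelIdeal (k κ : Type*) [Field k] [Fintype k] [Field κ] [Algebra k κ] (h : ℕ) :
    Ideal (MvPolynomial (Fin h) (DefRing κ h)) :=
  Ideal.span (Set.range fun n : ℕ =>
    (levelPoly k (fun r => (MvPolynomial.X r : MvPolynomial (Fin h) (DefRing κ h))) -
      (univPi k κ h).map MvPolynomial.C).coeff n)

/-- The ring `𝒜(π)` which classifies deformations with Drinfeld level `π` structure, that is, Drinfeld
bases of `𝓕^univ[π]` (see `isDrinfeldBasis_iff`).  It is finite over `𝒜`, and `𝔛(π)` is its rigid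
generic fibre. -/
def LevelRing (k κ : Type*) [Field k] [Fintype k] [Field κ] [Algebra k κ] (h : ℕ) : Type _ :=
  MvPolynomial (Fin h) (DefRing κ h) ⧸ levelIdeal k κ h

instance (k κ : Type*) [Field k] [Fintype k] [Field κ] [Algebra k κ] (h : ℕ) :
    CommRing (LevelRing k κ h) :=
  inferInstanceAs (CommRing (MvPolynomial (Fin h) (DefRing κ h) ⧸ levelIdeal k κ h))

instance (k κ : Type*) [Field k] [Fintype k] [Field κ] [Algebra k κ] (h : ℕ) :
    Algebra (DefRing κ h) (LevelRing k κ h) :=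
  inferInstanceAs (Algebra (DefRing κ h) (MvPolynomial (Fin h) (DefRing κ h) ⧸ levelIdeal k κ h))

/-- The coordinate `X_r^{(1)}` of `𝒜(π)`. -/
def levelX (k κ : Type*) [Field k] [Fintype k] [Field κ] [Algebra k κ] {h : ℕ} (r : Fin h) :
    LevelRing k κ h :=
  Ideal.Quotient.mk (levelIdeal k κ h) (MvPolynomial.X r)

section

variable {k κ : Type*} [Field k] [Fintype k] [Field κ] {h : ℕ}
  {R : Type*} [CommRing R] [Algebra k R] [Algebra (DefRing κ h) R]

lemma levelPoly_eq_of_isDrinfeldBasis [IsLocalRing R] [IsNoetherianRing R] (hh : 1 ≤ h)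
    [IsLocalHom (algebraMap (DefRing κ h) R)] {x : Fin h → R}
    (hx : IsDrinfeldBasis k κ x) :
    levelPoly k x = (univPi k κ h).map (algebraMap (DefRing κ h) R) := by
  classical
  obtain ⟨hm, c, hc⟩ := hx
  set P := levelPoly k x with hP
  set Q := (univPi k κ h).map (algebraMap (DefRing κ h) R) with hQ
  set N := Fintype.card k ^ h with hN
  have hq : 1 < Fintype.card k := Fintype.one_lt_card
  -- `Q` is monic of degree `N` up to lower terms, and so is `P`
  have hPm : P.Monic := monic_prod_of_monic _ _ fun a _ => monic_X_sub_C _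
  have hPd : P.natDegree = N := by
    rw [hP, levelPoly, natDegree_prod_of_monic _ _ fun a _ => monic_X_sub_C _]
    simp_rw [natDegree_X_sub_C]
    simp [hN]
  have hQd : (Q - X ^ N).degree < (N : WithBot ℕ) := by
    have : Q - X ^ N = C (algebraMap (DefRing κ h) R (MvPowerSeries.C PowerSeries.X)) * X +
        ∑ i : Fin (h - 1), C (algebraMap (DefRing κ h) R (MvPowerSeries.X i)) *
          X ^ Fintype.card k ^ (i.val + 1) := by
      simp [hQ, univPi, piPoly, Polynomial.map_sum, hN]
    rw [this]
    refine (degree_add_le _ _).trans_lt (max_lt ?_ ?_)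
    · refine (degree_C_mul_X_le _).trans_lt ?_
      exact_mod_cast Nat.one_lt_pow (by omega) hq
    · refine (degree_sum_le _ _).trans_lt ((Finset.sup_lt_iff (WithBot.bot_lt_coe _)).2 ?_)
      intro i _
      refine (degree_C_mul_X_pow_le _ _).trans_lt ?_
      exact_mod_cast Nat.pow_lt_pow_right hq (by omega)
  have hPX : (P - X ^ N).degree < (N : WithBot ℕ) := by
    have h1 : P.degree = N := by rw [degree_eq_natDegree hPm.ne_zero, hPd]
    have := degree_sub_lt_left (p := P) (q := X ^ N) (by rw [h1, degree_X_pow]) hPm.ne_zero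
      (by rw [hPm.leadingCoeff, (monic_X_pow N).leadingCoeff])
    rwa [h1] at this
  have hD : (Q - P).degree < (N : WithBot ℕ) := by
    have : Q - P = (Q - X ^ N) - (P - X ^ N) := by ring
    rw [this]
    exact (degree_sub_le _ _).trans_lt (max_lt hQd hPX)
  -- modulo the maximal ideal, `P` is `X ^ N`
  have hPr : ∀ n, (P - X ^ N).coeff n ∈ IsLocalRing.maximalIdeal R := by
    intro n
    rw [← Ideal.Quotient.eq_zero_iff_mem, ← coeff_map]
    have h0 : ∀ a : Fin h → k, Ideal.Quotient.mk (IsLocalRing.maximalIdeal R)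
        (∑ r, a r • x r) = 0 := fun a => Ideal.Quotient.eq_zero_iff_mem.2
      (sum_mem fun r _ => by
        rw [Algebra.smul_def]; exact Ideal.mul_mem_left _ _ (hm r))
    have : P.map (Ideal.Quotient.mk (IsLocalRing.maximalIdeal R)) = X ^ N := by
      rw [hP, levelPoly, Polynomial.map_prod]
      simp only [Polynomial.map_sub, Polynomial.map_X, Polynomial.map_C, h0]
      simp [hN]
    simp [this]
  have hcD : ((Q - P : R[X]) : PowerSeries R) = (P : PowerSeries R) * (c - 1) := by
    rw [Polynomial.coe_sub, hc]; ring
  have key : ∀ n : ℕ, ∀ j, PowerSeries.coeff j (c - 1) ∈ IsLocalRing.maximalIdeal R ^ n := by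
    intro n
    induction n with
    | zero => intro j; simp
    | succ n ih =>
      intro j
      have h1 : PowerSeries.coeff (j + N) ((Q - P : R[X]) : PowerSeries R) = 0 := by
        rw [Polynomial.coeff_coe]
        exact coeff_eq_zero_of_degree_lt (hD.trans_le (by exact_mod_cast Nat.le_add_left _ _))
      have h2 : (P : PowerSeries R) = PowerSeries.X ^ N + ((P - X ^ N : R[X]) : PowerSeries R) := by
        simp
      rw [hcD, h2, add_mul, map_add, PowerSeries.coeff_X_pow_mul, PowerSeries.coeff_mul] at h1
      rw [eq_neg_of_add_eq_zero_left h1]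
      refine neg_mem (sum_mem fun p _ => ?_)
      rw [pow_succ', Polynomial.coeff_coe]
      exact Ideal.mul_mem_mul (hPr _) (ih _)
  have hc1 : c - 1 = 0 := by
    ext j
    have : PowerSeries.coeff j (c - 1) ∈ ⨅ n : ℕ, IsLocalRing.maximalIdeal R ^ n :=
      Ideal.mem_iInf.2 fun n => key n j
    rw [Ideal.iInf_pow_eq_bot_of_isLocalRing _ (Ideal.IsPrime.ne_top')] at this
    simpa using this
  rw [hc1, mul_zero] at hcD
  have : (Q - P : R[X]) = 0 := by exact_mod_cast hcD
  exact (sub_eq_zero.1 this).symm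

variable [Algebra k κ] [IsScalarTower k (DefRing κ h) R]

lemma map_levelPoly (f : MvPolynomial (Fin h) (DefRing κ h) →ₐ[DefRing κ h] R) :
    (levelPoly k (fun r => (MvPolynomial.X r : MvPolynomial (Fin h) (DefRing κ h)))).map
      (f : MvPolynomial (Fin h) (DefRing κ h) →+* R) =
      levelPoly k (fun r => f (MvPolynomial.X r)) := by
  have hs : ∀ (c : k) (y : MvPolynomial (Fin h) (DefRing κ h)), f (c • y) = c • f y := by
    intro c y
    rw [← algebraMap_smul (DefRing κ h) c y, map_smul, algebraMap_smul]
  rw [levelPoly, levelPoly, Polynomial.map_prod]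
  refine Finset.prod_congr rfl fun a _ => ?_
  rw [Polynomial.map_sub, Polynomial.map_X, Polynomial.map_C, RingHom.coe_coe, map_sum]
  simp only [hs]

/-- `𝒜(π)` represents the functor of Drinfeld bases of `𝓕^univ[π]`. -/
theorem isDrinfeldBasis_iff [IsLocalRing R] [IsNoetherianRing R] (hh : 1 ≤ h)
    [IsLocalHom (algebraMap (DefRing κ h) R)] (x : Fin h → R) :
    IsDrinfeldBasis k κ x ↔
      ∃! f : LevelRing k κ h →ₐ[DefRing κ h] R, ∀ r, f (levelX k κ r) = x r := by
  constructor
  · intro hx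
    have hrel := levelPoly_eq_of_isDrinfeldBasis hh hx
    let g : MvPolynomial (Fin h) (DefRing κ h) →ₐ[DefRing κ h] R := MvPolynomial.aeval x
    have hg : ∀ a ∈ levelIdeal k κ h, g a = 0 := by
      intro a ha
      have : levelIdeal k κ h ≤ RingHom.ker g := by
        refine Ideal.span_le.2 ?_
        rintro _ ⟨n, rfl⟩
        change (g : MvPolynomial (Fin h) (DefRing κ h) →+* R) _ = 0
        rw [← coeff_map, Polynomial.map_sub, map_levelPoly, Polynomial.map_map]
        have h1 : (g : MvPolynomial (Fin h) (DefRing κ h) →+* R).comp MvPolynomial.C =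
            algebraMap (DefRing κ h) R := by
          ext1 a
          exact MvPolynomial.aeval_C x a
        have h2 : (fun r => g (MvPolynomial.X r)) = x := by
          ext r; exact MvPolynomial.aeval_X x r
        rw [h1, h2, hrel, sub_self, coeff_zero]
      exact this ha
    refine ⟨Ideal.Quotient.liftₐ (levelIdeal k κ h) g hg, fun r => ?_, fun f hf => ?_⟩
    · exact MvPolynomial.aeval_X x r
    · refine Ideal.Quotient.algHom_ext (DefRing κ h) (MvPolynomial.algHom_ext fun r => ?_)
      exact (hf r).trans (MvPolynomial.aeval_X x r).symm
  · rintro ⟨f, hf, -⟩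
    let g : MvPolynomial (Fin h) (DefRing κ h) →ₐ[DefRing κ h] R :=
      f.comp (Ideal.Quotient.mkₐ (DefRing κ h) (levelIdeal k κ h))
    have h2 : (fun r => g (MvPolynomial.X r)) = x := by
      ext r; exact hf r
    have h1 : (g : MvPolynomial (Fin h) (DefRing κ h) →+* R).comp MvPolynomial.C =
        algebraMap (DefRing κ h) R := by
      ext1 a
      exact g.commutes a
    have hrel : levelPoly k x = (univPi k κ h).map (algebraMap (DefRing κ h) R) := by
      rw [← h2, ← map_levelPoly, ← h1, ← Polynomial.map_map, ← sub_eq_zero, ← Polynomial.map_sub]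
      ext n
      rw [coeff_map, coeff_zero]
      have : (levelPoly k (fun r => (MvPolynomial.X r : MvPolynomial (Fin h) (DefRing κ h))) -
          (univPi k κ h).map MvPolynomial.C).coeff n ∈ levelIdeal k κ h :=
        Ideal.subset_span ⟨n, rfl⟩
      change f (Ideal.Quotient.mk (levelIdeal k κ h) _) = 0
      rw [Ideal.Quotient.eq_zero_iff_mem.2 this]
      exact map_zero f
    refine ⟨fun r => ?_, by rw [hrel]⟩
    -- `x r` is a root of `[π]`, which reduces to `X ^ q ^ h`
    classical
    have hroot : ((univPi k κ h).map (algebraMap (DefRing κ h) R)).eval (x r) = 0 := by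
      rw [← hrel, levelPoly, eval_prod]
      refine Finset.prod_eq_zero (Finset.mem_univ (Pi.single r 1)) ?_
      simp [Pi.single_apply, ite_smul]
    have hmem : ∀ a : DefRing κ h, MvPowerSeries.constantCoeff a = PowerSeries.X ∨
        MvPowerSeries.constantCoeff a = 0 → algebraMap (DefRing κ h) R a ∈
        IsLocalRing.maximalIdeal R := by
      intro a ha
      rw [IsLocalRing.mem_maximalIdeal, mem_nonunits_iff]
      intro hu
      have := (isUnit_of_map_unit (algebraMap (DefRing κ h) R) a hu).map
        (MvPowerSeries.constantCoeff (σ := Fin (h - 1)) (R := PowerSeries κ))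
      rcases ha with ha | ha
      · rw [ha, PowerSeries.isUnit_iff_constantCoeff] at this
        simp at this
      · rw [ha] at this
        exact not_isUnit_zero this
    have hq0 : Fintype.card k ≠ 0 := Fintype.card_ne_zero
    have hx : x r ^ Fintype.card k ^ h ∈ IsLocalRing.maximalIdeal R := by
      simp only [univPi, piPoly, Polynomial.map_add, Polynomial.map_mul, Polynomial.map_C,
        Polynomial.map_X, Polynomial.map_pow, Polynomial.map_sum, eval_add, eval_mul, eval_C,
        eval_X, eval_pow, eval_finsetSum] at hroot
      rw [eq_neg_of_add_eq_zero_right hroot]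
      refine neg_mem (add_mem (Ideal.mul_mem_right _ _ (hmem _ (Or.inl ?_)))
        (sum_mem fun i _ => Ideal.mul_mem_right _ _ (hmem _ (Or.inr ?_))))
      · simp
      · simp
    exact Ideal.IsPrime.mem_of_pow_mem inferInstance _ hx

end

/-! ### The field `E₁` -/

/-- The completed maximal unramified extension `κ((π))` of `F` (and of the unramified extension `E`
of `F` of degree `h`). -/
abbrev UnrField (κ : Type*) [Field κ] : Type _ := LaurentSeries κ

/-- `[π]_{𝓕₀}(T) = π T + T^{q^h}`, over `κ((π))`. -/
def specialPi (k κ : Type*) [Field k] [Fintype k] [Field κ] (h : ℕ) : (UnrField κ)[X] :=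
  piPoly (Fintype.card k) h (algebraMap (PowerSeries κ) (UnrField κ) PowerSeries.X) (fun _ => 0)

/-- `E₁`, the field obtained from `κ((π))` by adjoining the roots of `[π]_{𝓕₀}`. -/
abbrev E₁ (k κ : Type*) [Field k] [Fintype k] [Field κ] (h : ℕ) : Type _ :=
  (specialPi k κ h).SplittingField

section

variable (k κ : Type*) [Field k] [Fintype k] [Field κ] (h : ℕ)

/-- The uniformizer `π` of `F` as an element of `E₁`. -/
def pi : E₁ k κ h := algebraMap (PowerSeries κ) (E₁ k κ h) PowerSeries.X

/-- The ring of integers of `E₁`. -/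
def integers : Subring (E₁ k κ h) := (integralClosure (PowerSeries κ) (E₁ k κ h)).toSubring

lemma aeval_specialPi (y : E₁ k κ h) :
    aeval y (specialPi k κ h) = pi k κ h * y + y ^ Fintype.card k ^ h := by
  simp only [specialPi, piPoly, map_zero, zero_mul, Finset.sum_const_zero, add_zero, map_add,
    map_mul, aeval_X, aeval_C, map_pow, pi]
  rw [← IsScalarTower.algebraMap_apply (PowerSeries κ) (UnrField κ) (E₁ k κ h)]

/-- `𝓕₀[π]`, the `k`-vector space of roots of `[π]_{𝓕₀}(T) = π T + T^{q^h}` in `E₁`. -/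
def torsion [Algebra k κ] : Submodule k (E₁ k κ h) where
  carrier := {y | aeval y (specialPi k κ h) = 0}
  add_mem' := by
    intro a b ha hb
    have h1 : ∀ y : E₁ k κ h, (FiniteField.frobeniusAlgHom k (E₁ k κ h) ^ h) y
        = y ^ Fintype.card k ^ h := fun y => by
      simp [AlgHom.coe_pow, FiniteField.coe_frobeniusAlgHom, pow_iterate]
    simp only [Set.mem_ofPred_eq, aeval_specialPi, ← h1, map_add] at ha hb ⊢
    linear_combination ha + hb
  zero_mem' := by
    simp [aeval_specialPi]
  smul_mem' := by
    intro c y hy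
    have h1 : ∀ y : E₁ k κ h, (FiniteField.frobeniusAlgHom k (E₁ k κ h) ^ h) y
        = y ^ Fintype.card k ^ h := fun y => by
      simp [AlgHom.coe_pow, FiniteField.coe_frobeniusAlgHom, pow_iterate]
    simp only [Set.mem_ofPred_eq, aeval_specialPi, ← h1, map_smul, mul_smul_comm] at hy ⊢
    rw [← smul_add, hy, smul_zero]

/-! ### Tate algebras -/

lemma pi_ne_zero : pi k κ h ≠ 0 := by
  intro h0
  have hinj : Function.Injective (algebraMap (PowerSeries κ) (E₁ k κ h)) := by
    rw [IsScalarTower.algebraMap_eq (PowerSeries κ) (UnrField κ) (E₁ k κ h)]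
    exact (algebraMap (UnrField κ) (E₁ k κ h)).injective.comp
      (IsFractionRing.injective (PowerSeries κ) (UnrField κ))
  exact PowerSeries.X_ne_zero (hinj (h0.trans (map_zero _).symm))

lemma pi_mem : pi k κ h ∈ integers k κ h :=
  (integralClosure (PowerSeries κ) (E₁ k κ h)).algebraMap_mem _

/-- Every element of `E₁` has the form `π^{-N} z` with `z` integral. -/
lemma exists_pow_mul_mem (y : E₁ k κ h) : ∃ N : ℕ, pi k κ h ^ N * y ∈ integers k κ h := by
  have halg : IsAlgebraic (PowerSeries κ) y :=
    (IsFractionRing.isAlgebraic_iff (PowerSeries κ) (UnrField κ) (E₁ k κ h)).2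
      (Algebra.IsAlgebraic.isAlgebraic y)
  obtain ⟨a, ha, hay⟩ := halg.exists_integral_multiple
  have hX : PowerSeries.X ^ a.order.toNat * PowerSeries.divXPowOrder a = a :=
    PowerSeries.X_pow_order_mul_divXPowOrder
  obtain ⟨u, hu⟩ := PowerSeries.isUnit_divided_by_X_pow_order ha
  refine ⟨a.order.toNat, ?_⟩
  have h2 := (integralClosure (PowerSeries κ) (E₁ k κ h)).smul_mem hay (↑u⁻¹ : PowerSeries κ)
  have h3 : (↑u⁻¹ : PowerSeries κ) • a • y = pi k κ h ^ a.order.toNat * y := by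
    rw [smul_smul]
    nth_rewrite 1 [← hX]
    rw [← hu, mul_comm, mul_assoc, Units.mul_inv, mul_one, Algebra.smul_def, map_pow, pi]
  rw [h3] at h2
  exact h2

/-- The Tate algebra `E₁⟨V₁, …, V_n⟩`: power series whose coefficients tend to zero, i.e. for every
`N` all but finitely many coefficients lie in `π^N 𝒪_{E₁}`. -/
def tateSubalgebra (n : ℕ) : Subalgebra (E₁ k κ h) (MvPowerSeries (Fin n) (E₁ k κ h)) where
  carrier := {f | ∀ N : ℕ, {m | ¬ ∃ z ∈ integers k κ h, MvPowerSeries.coeff m f = pi k κ h ^ N * z}.Finite}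
  mul_mem' := by
    classical
    have bdd : ∀ f : MvPowerSeries (Fin n) (E₁ k κ h),
        {m | ¬ ∃ z ∈ integers k κ h, MvPowerSeries.coeff m f = pi k κ h ^ 0 * z}.Finite →
        ∃ M : ℕ, ∀ m, pi k κ h ^ M * MvPowerSeries.coeff m f ∈ integers k κ h := by
      intro f hf
      choose c hc using fun m => exists_pow_mul_mem k κ h (MvPowerSeries.coeff m f)
      refine ⟨hf.toFinset.sup c, fun m => ?_⟩
      by_cases hm : m ∈ hf.toFinset
      · obtain ⟨d, hd⟩ := Nat.exists_eq_add_of_le (Finset.le_sup (f := c) hm)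
        rw [hd, add_comm, pow_add, mul_assoc]
        exact mul_mem (pow_mem (pi_mem k κ h) d) (hc m)
      · simp only [Set.Finite.mem_toFinset, Set.mem_ofPred_eq, not_not] at hm
        obtain ⟨z, hz, hz'⟩ := hm
        rw [hz']
        exact mul_mem (pow_mem (pi_mem k κ h) _) (mul_mem (pow_mem (pi_mem k κ h) _) hz)
    intro f g hf hg N
    obtain ⟨M, hM⟩ := bdd f (hf 0)
    obtain ⟨M', hM'⟩ := bdd g (hg 0)
    refine ((hf (N + M')).add (hg (N + M))).subset fun m hm => ?_
    by_contra hcon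
    refine hm ?_
    have key : ∀ p ∈ Finset.HasAntidiagonal.antidiagonal m, ∃ z ∈ integers k κ h,
        MvPowerSeries.coeff p.1 f * MvPowerSeries.coeff p.2 g = pi k κ h ^ N * z := by
      intro p hp
      by_cases h1 : ∃ z ∈ integers k κ h, MvPowerSeries.coeff p.1 f = pi k κ h ^ (N + M') * z
      · obtain ⟨z, hz, hz'⟩ := h1
        exact ⟨z * (pi k κ h ^ M' * MvPowerSeries.coeff p.2 g), mul_mem hz (hM' _), by
          rw [hz']; ring⟩
      · by_cases h2 : ∃ z ∈ integers k κ h, MvPowerSeries.coeff p.2 g = pi k κ h ^ (N + M) * z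
        · obtain ⟨z, hz, hz'⟩ := h2
          exact ⟨z * (pi k κ h ^ M * MvPowerSeries.coeff p.1 f), mul_mem hz (hM _), by
            rw [hz']; ring⟩
        · exact absurd (Set.add_mem_add (s := {m | ¬ ∃ z ∈ integers k κ h,
              MvPowerSeries.coeff m f = pi k κ h ^ (N + M') * z}) h1 h2) (by rwa [Finset.HasAntidiagonal.mem_antidiagonal.1 hp])
    choose! z hz hz' using key
    refine ⟨∑ p ∈ Finset.HasAntidiagonal.antidiagonal m, z p, sum_mem hz, ?_⟩
    rw [MvPowerSeries.coeff_mul, Finset.mul_sum]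
    exact Finset.sum_congr rfl hz'
  add_mem' := by
    intro f g hf hg N
    refine ((hf N).union (hg N)).subset fun m hm => ?_
    by_contra hcon
    simp only [Set.mem_union, Set.mem_ofPred_eq, not_or, not_not] at hcon
    obtain ⟨⟨z, hz, hz'⟩, w, hw, hw'⟩ := hcon
    exact hm ⟨z + w, add_mem hz hw, by rw [map_add, hz', hw', mul_add]⟩
  algebraMap_mem' := by
    classical
    intro c N
    refine (Set.finite_singleton 0).subset fun m hm => ?_
    by_contra hm0
    refine hm ⟨0, zero_mem _, ?_⟩
    rw [MvPowerSeries.algebraMap_apply, MvPowerSeries.coeff_C]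
    simp_all

/-- The Tate algebra `E₁⟨V₁, …, V_n⟩` as a type, with its structure of `E₁`-algebra. -/
def TateAlgebra (n : ℕ) : Type _ := tateSubalgebra k κ h n

instance (n : ℕ) : CommRing (TateAlgebra k κ h n) :=
  inferInstanceAs (CommRing (tateSubalgebra k κ h n))

instance (n : ℕ) : Algebra (E₁ k κ h) (TateAlgebra k κ h n) :=
  inferInstanceAs (Algebra (E₁ k κ h) (tateSubalgebra k κ h n))

variable {k κ h} in
/-- The power series of an element of the Tate algebra. -/
def TateAlgebra.toSeries {n : ℕ} : TateAlgebra k κ h n →ₐ[E₁ k κ h] MvPowerSeries (Fin n) (E₁ k κ h) :=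
  (tateSubalgebra k κ h n).val

/-- `𝒪_{E₁}⟨V₁, …, V_n⟩`, the ring of integral analytic functions on the closed unit polydisc. -/
def integralTate (n : ℕ) : Subring (TateAlgebra k κ h n) where
  carrier := {f | ∀ m, MvPowerSeries.coeff m f.toSeries ∈ integers k κ h}
  mul_mem' := by
    classical
    intro f g hf hg m
    rw [map_mul, MvPowerSeries.coeff_mul]
    exact sum_mem fun p _ => mul_mem (hf _) (hg _)
  one_mem' := by
    classical
    intro m
    rw [map_one, MvPowerSeries.coeff_one]
    split_ifs
    exacts [one_mem _, zero_mem _]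
  add_mem' := by
    intro f g hf hg m
    rw [map_add, map_add]
    exact add_mem (hf m) (hg m)
  zero_mem' := by
    intro m
    rw [map_zero, map_zero]
    exact zero_mem _
  neg_mem' := by
    intro f hf m
    rw [map_neg, map_neg]
    exact neg_mem (hf m)

/-- The map `𝒜 → E₁⟨V₁, …, V_{h-1}⟩`, `u_i ↦ π V_i`. -/
def defToTate : DefRing κ h →+* TateAlgebra k κ h (h - 1) :=
  RingHom.codRestrict
    ((MvPowerSeries.rescale (fun _ => pi k κ h)).comp
      (MvPowerSeries.map (algebraMap (PowerSeries κ) (E₁ k κ h))))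
    (tateSubalgebra k κ h (h - 1)) (by
      intro f N
      refine (Finsupp.finite_of_degree_le N).subset fun m hm => ?_
      by_contra hcon
      refine hm ⟨pi k κ h ^ (m.degree - N) *
        algebraMap (PowerSeries κ) (E₁ k κ h) (MvPowerSeries.coeff m f),
        mul_mem (pow_mem (pi_mem k κ h) _)
          ((integralClosure (PowerSeries κ) (E₁ k κ h)).algebraMap_mem _), ?_⟩
      have hN : N ≤ m.degree := le_of_not_ge hcon
      rw [RingHom.comp_apply, MvPowerSeries.coeff_rescale, MvPowerSeries.coeff_map, ← mul_assoc,
        ← pow_add, Nat.add_sub_cancel' hN, Finsupp.prod, Finset.prod_pow_eq_pow_sum, Finsupp.degree_apply])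

/-- The structure of `𝒜`-algebra on `E₁⟨V₁, …, V_{h-1}⟩` given by `u_i ↦ π V_i`; this is the
inclusion of the affinoid `𝔛(1)¹ ⊗ E₁`, defined by `v(u_i) ≥ 1`, into `𝔛(1)`. -/
instance tateAlgebraOverDef : Algebra (DefRing κ h) (TateAlgebra k κ h (h - 1)) :=
  (defToTate k κ h).toAlgebra

/-- The functions `V_i = π⁻¹ u_i` on `𝔛(1)¹`. -/
def V (i : Fin (h - 1)) : TateAlgebra k κ h (h - 1) :=
  (pi k κ h)⁻¹ • algebraMap (DefRing κ h) (TateAlgebra k κ h (h - 1)) (MvPowerSeries.X i)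

/-- `V_j` for a natural number `j`, with the conventions `V_0 = 1` and `V_j = 0` for `j ≥ h`. -/
def Vnat (j : ℕ) : TateAlgebra k κ h (h - 1) :=
  if j = 0 then 1 else if hj : j - 1 < h - 1 then V k κ h ⟨j - 1, hj⟩ else 0

/-- The matrix whose rows are, for `i = 0, …, h - 1`,
`(V_{1-i}^{q^i}, V_{2-i}^{q^i}, …, V_{h-1-i}^{q^i} ∣ x^{q^i} + π x V_{h-i}^{q^i})`, where `V_0 = 1`,
`V_j = 0` for `j < 0`, and where the last entry of the first row is just `x`. -/
def sectionMatrix (x : E₁ k κ h) : Matrix (Fin h) (Fin h) (TateAlgebra k κ h (h - 1)) :=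
  Matrix.of fun i j =>
    if j.val + 1 < h then
      if i.val ≤ j.val + 1 then Vnat k κ h (j.val + 1 - i.val) ^ Fintype.card k ^ i.val else 0
    else if i.val = 0 then algebraMap _ _ x
    else algebraMap _ _ (x ^ Fintype.card k ^ i.val) +
      algebraMap _ _ (pi k κ h * x) * Vnat k κ h (h - i.val) ^ Fintype.card k ^ i.val

/-- `f ≡ g` modulo `π^α` in `𝒪_{E₁}⟨V₁, …, V_n⟩`, for a rational exponent `α`: both functions are
integral and their difference is `c` times an integral function, with `c` an element of `E₁` of
valuation `α`, namely `c = π^α`, that is `c^b = π^a` for `α = a / b`. -/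
def CongrModPi {n : ℕ} (α : ℚ) (f g : TateAlgebra k κ h n) : Prop :=
  f ∈ integralTate k κ h n ∧ g ∈ integralTate k κ h n ∧
    ∃ c : E₁ k κ h, c ^ α.den = pi k κ h ^ α.num ∧ ∃ e ∈ integralTate k κ h n, f - g = c • e

/-! ### The preimage of `𝔛(1)¹ ⊗ E₁` in `𝔛(π) ⊗ E₁` -/

variable [Algebra k κ]

/-- The affinoid algebra of the preimage of `𝔛(1)¹ ⊗ E₁` in `𝔛(π) ⊗ E₁`.  The preimage is the fibre
product of `𝔛(π)` and `𝔛(1)¹ ⊗ E₁` over `𝔛(1)`, and `𝔛(π) → 𝔛(1)` is finite, so its algebra is the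
tensor product of `𝒜(π)` and `E₁⟨V₁, …, V_{h-1}⟩` over `𝒜`. -/
abbrev PreimageRing : Type _ := TateAlgebra k κ h (h - 1) ⊗[DefRing κ h] LevelRing k κ h

variable {h}

/-- The function `X_r^{(1)}` on the preimage. -/
def coordX (r : Fin h) : PreimageRing k κ h := 1 ⊗ₜ levelX k κ r

variable {k κ}

/-- The point `m` of the preimage lies above the point `x^{(0)} = (u₁ = ⋯ = u_{h-1} = 0)` of `𝔛(1)`,
which corresponds to `𝓕₀`. -/
def IsAboveSpecial (m : MaximalSpectrum (PreimageRing k κ h)) : Prop :=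
  ∀ i, algebraMap (TateAlgebra k κ h (h - 1)) (PreimageRing k κ h) (V k κ h i) ∈ m.asIdeal

/-- At the point `m` the functions `X_r^{(1)}` take the values `x_r`. -/
def HasCoordinates (m : MaximalSpectrum (PreimageRing k κ h)) (x : Fin h → E₁ k κ h) : Prop :=
  ∀ r, coordX k κ r - algebraMap (E₁ k κ h) (PreimageRing k κ h) (x r) ∈ m.asIdeal

/-- The points of the polydisc in the preimage that is the image of the section
`𝔛(1)¹ ⊗ E₁ = Sp E₁⟨V₁, …, V_{h-1}⟩ → 𝔛(π) ⊗ E₁` given on functions by `σ`. -/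
def polydisc (σ : PreimageRing k κ h →ₐ[TateAlgebra k κ h (h - 1)] TateAlgebra k κ h (h - 1)) :
    Set (MaximalSpectrum (PreimageRing k κ h)) :=
  {m | RingHom.ker σ ≤ m.asIdeal}

end

end LubinTate

end

open LubinTate

/-! Over the polydisc, multiplication by $\pi$ is $\pi s+\pi\sum V_i s^{q^i}+s^{q^h}$. Fix a root
$x$ of $[\pi]_{\mathscr F_0}$, so $x^{q^h}=-\pi x$. Substituting $s=x(1+G)$ and dividing by $\pi x$
gives $G+\sum W_i(1+G^{q^i})=G^{q^h}$ with $W_i=x^{q^i-1}V_i$. Hensel's lemma solves this equation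
in $k[[W]]$ with $G(0)=0$. Since powers of $x$ become divisible by powers of $\pi$, the resulting
$s$ lies in the Tate algebra $T$ (`torsionFun`).

A root of $[\pi]$ in $T$ is determined by its value at the origin, and a nonzero root divides $\pi$,
hence is a unit. So $x\mapsto s$ is $k$-linear (`torsionLift`), and $[\pi]$ is the product of the
$X-s_y$, whose roots have unit differences (`map_univPi_eq_prod`). Lagrange interpolation at these
roots, one factor for each $X_r^{(1)}$, splits $T\otimes\mathcal A(\pi)$ by idempotents indexed by
tuples of torsion points. A dependent tuple contributes zero and a basis contributes one copy of $T$
(`polydiscHom_bijective`).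

For the congruence put $\rho=\sum_{i<h}V_i s^{q^i}$ with $V_0=1$, so that $s^{q^h}=-\pi\rho$.
Raising $s\equiv x \pmod{x^q}$ to the power $q^h$ and cancelling $\pi$ gives $\rho\equiv x$ modulo
$c=\pi^{q-1}x^q$. Inverting the triangular Frobenius system for $s$ in terms of $\rho$ gives the
Hessenberg determinant (`sub_sum_cofactorSeq_mem`, `exists_torsionLift_sub_det_eq_mul`), and $c$ has
the required valuation because $x^{q^h-1}=-\pi$. -/

noncomputable section

namespace LubinTate

/-! ### Frobenius powers and the polynomials $[\pi]$ -/

section Frobenius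

variable (k : Type*) [Field k] [Fintype k] {R : Type*} [CommRing R] [Algebra k R]

/-- The map `a ↦ a ^ q ^ i` on a `k`-algebra. -/
def frobPow (i : ℕ) : R →ₐ[k] R := FiniteField.frobeniusAlgHom k R ^ i

lemma frobPow_apply (i : ℕ) (a : R) : frobPow k i a = a ^ Fintype.card k ^ i := by
  simp [frobPow, AlgHom.coe_pow, FiniteField.coe_frobeniusAlgHom, pow_iterate]

/-- The additive map `a ↦ ϖ a + u₁ a^q + ⋯ + u_{h-1} a^{q^{h-1}} + a^{q^h}`. -/
def piMap (h : ℕ) (ϖ : R) (u : Fin (h - 1) → R) : R →ₗ[k] R :=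
  ϖ • LinearMap.id + ∑ i, u i • (frobPow k (i.val + 1)).toLinearMap + (frobPow k h).toLinearMap

lemma piMap_apply (h : ℕ) (ϖ : R) (u : Fin (h - 1) → R) (a : R) :
    piMap k h ϖ u a = ϖ * a + ∑ i, u i * a ^ Fintype.card k ^ (i.val + 1) +
      a ^ Fintype.card k ^ h := by
  simp [piMap, frobPow_apply]

lemma eval_piPoly (h : ℕ) (ϖ : R) (u : Fin (h - 1) → R) (a : R) :
    (piPoly (Fintype.card k) h ϖ u).eval a = piMap k h ϖ u a := by
  simp [piMap_apply, piPoly, eval_finsetSum]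

end Frobenius

section PiPoly

variable {R S : Type*} [CommRing R] [CommRing S]

lemma map_piPoly (q h : ℕ) (ϖ : R) (u : Fin (h - 1) → R) (f : R →+* S) :
    (piPoly q h ϖ u).map f = piPoly q h (f ϖ) (fun i => f (u i)) := by
  simp [piPoly, Polynomial.map_sum]

lemma degree_piPoly_sub_lt {q h : ℕ} (hq : 1 < q) (hh : 1 ≤ h) (ϖ : R) (u : Fin (h - 1) → R) :
    (C ϖ * X + ∑ i : Fin (h - 1), C (u i) * X ^ q ^ (i.val + 1)).degree <
      ((q ^ h : ℕ) : WithBot ℕ) := by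
  refine (degree_add_le _ _).trans_lt (max_lt ?_ ?_)
  · refine (degree_C_mul_X_le _).trans_lt ?_
    exact_mod_cast Nat.one_lt_pow (by omega) hq
  · refine (degree_sum_le _ _).trans_lt ((Finset.sup_lt_iff (WithBot.bot_lt_coe _)).2 ?_)
    intro i _
    refine (degree_C_mul_X_pow_le _ _).trans_lt ?_
    exact_mod_cast Nat.pow_lt_pow_right hq (by omega)

lemma monic_piPoly {q h : ℕ} (hq : 1 < q) (hh : 1 ≤ h) (ϖ : R) (u : Fin (h - 1) → R) :
    (piPoly q h ϖ u).Monic := by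
  rw [piPoly, add_comm]
  exact monic_X_pow_add (degree_piPoly_sub_lt hq hh ϖ u)

lemma natDegree_piPoly [Nontrivial R] {q h : ℕ} (hq : 1 < q) (hh : 1 ≤ h) (ϖ : R)
    (u : Fin (h - 1) → R) : (piPoly q h ϖ u).natDegree = q ^ h := by
  rw [piPoly, natDegree_add_eq_right_of_degree_lt, natDegree_X_pow]
  rw [degree_X_pow]
  exact degree_piPoly_sub_lt hq hh ϖ u

lemma coeff_one_piPoly {q h : ℕ} (hq : 1 < q) (hh : 1 ≤ h) (ϖ : R) (u : Fin (h - 1) → R) :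
    (piPoly q h ϖ u).coeff 1 = ϖ := by
  have h1 : ∀ j, j ≠ 0 → (1 : ℕ) ≠ q ^ j := fun j hj => (Nat.one_lt_pow hj hq).ne
  simp only [piPoly, coeff_add, coeff_C_mul, coeff_X_one, finsetSum_coeff, coeff_X_pow]
  simp [h1, show h ≠ 0 by omega]

/-- All exponents except the first are powers of $q$, which vanishes in `R`. The constant derivative
makes approximate roots simple in Hensel's lemma and makes `specialPi` separable. -/
lemma derivative_piPoly {q h : ℕ} (hq : (q : R) = 0) (hh : 1 ≤ h) (ϖ : R) (u : Fin (h - 1) → R) :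
    derivative (piPoly q h ϖ u) = C ϖ := by
  simp [piPoly, derivative_X_pow, hq, zero_pow (show h ≠ 0 by omega)]

end PiPoly

/-! ### The universal root, by Hensel's lemma -/

lemma exists_root_of_henselian (k : Type*) [Field k] [Fintype k] {A : Type*} [CommRing A]
    [Nontrivial A] [Algebra k A] (I : Ideal A) [HenselianRing A I] {h : ℕ} (hh : 1 ≤ h)
    (W : Fin (h - 1) → A) (hW : ∀ i, W i ∈ I) :
    ∃ G ∈ I, G + ∑ i, W i * (1 + G ^ Fintype.card k ^ (i.val + 1)) = G ^ Fintype.card k ^ h := by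
  have hq1 : 1 < Fintype.card k := Fintype.one_lt_card
  have hqA : ((Fintype.card k : ℕ) : A) = 0 := by
    rw [← map_natCast (algebraMap k A), FiniteField.cast_card_eq_zero, map_zero]
  -- The equation is $f(G)=0$, where $f$ has constant derivative $-1$ and $f(0)=-\sum W_i$ lies in
  -- `I`; thus $0$ is a simple approximate root.
  let P : A[X] := piPoly (Fintype.card k) h (-1) (fun i => -W i)
  let f : A[X] := P - C (∑ i, W i)
  have hf : f.Monic := by
    refine (monic_piPoly hq1 hh _ _).sub_of_left (degree_C_le.trans_lt ?_)
    rw [degree_eq_natDegree (monic_piPoly hq1 hh _ _).ne_zero, natDegree_piPoly hq1 hh]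
    exact_mod_cast Nat.pow_pos (by omega)
  obtain ⟨G, hG, hG0⟩ := HenselianRing.is_henselian (I := I) f hf 0 (by
      simp only [f, P, eval_sub, eval_piPoly, eval_C, map_zero, zero_sub]
      exact neg_mem (sum_mem fun i _ => hW i)) (by
      simp [f, P, derivative_piPoly hqA hh])
  refine ⟨G, by simpa using hG0, ?_⟩
  simp only [IsRoot, f, P, eval_sub, eval_piPoly, eval_C, piMap_apply] at hG
  simp only [mul_add, mul_one, Finset.sum_add_distrib]
  simp only [neg_mul, Finset.sum_neg_distrib, one_mul] at hG
  linear_combination -hG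

/-- The universal solution of `G = G^{q^h} - ∑ W_i (1 + G^{q^i})` in power series over `k`. -/
lemma exists_rootSeries (k : Type*) [Field k] [Fintype k] {h : ℕ} (hh : 1 ≤ h) :
    ∃ G : MvPowerSeries (Fin (h - 1)) k, MvPowerSeries.constantCoeff G = 0 ∧
      G + ∑ i, MvPowerSeries.X i * (1 + G ^ Fintype.card k ^ (i.val + 1)) =
        G ^ Fintype.card k ^ h := by
  have hI : (Ideal.span (Set.range MvPowerSeries.X) : Ideal (MvPowerSeries (Fin (h - 1)) k)) ≤
      RingHom.ker (MvPowerSeries.constantCoeff (σ := Fin (h - 1)) (R := k)) := by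
    refine Ideal.span_le.2 ?_
    rintro _ ⟨i, rfl⟩
    exact MvPowerSeries.constantCoeff_X i
  obtain ⟨G, hG, hG'⟩ := exists_root_of_henselian k
    (Ideal.span (Set.range MvPowerSeries.X) : Ideal (MvPowerSeries (Fin (h - 1)) k)) hh
    MvPowerSeries.X fun i => Ideal.subset_span ⟨i, rfl⟩
  exact ⟨G, hI hG, hG'⟩

/-! ### Hessenberg determinants and inversion of Frobenius-triangular systems -/

section Hessenberg

variable {R : Type*} [CommRing R]

/-- Since `w 0 = 1`, replacing row $0$ by the combination of the rows with weights `w` preserves the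
determinant. The new row vanishes except in its last entry, and the complementary minor is
unitriangular. -/
lemma neg_one_pow_mul_det_hessenberg {n : ℕ} (M : Matrix (Fin (n + 1)) (Fin (n + 1)) R)
    (w : Fin (n + 1) → R) (h0 : w 0 = 1) (h1 : ∀ j : Fin n, M j.succ j.castSucc = 1)
    (h2 : ∀ (i : Fin (n + 1)) (j : Fin n), j.val + 1 < i.val → M i j.castSucc = 0)
    (hw : ∀ j : Fin n, ∑ i, w i * M i j.castSucc = 0) :
    (-1) ^ n * M.det = ∑ i, w i * M i (Fin.last n) := by
  have h3 := Matrix.det_updateRow_sum M 0 w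
  rw [h0, one_smul] at h3
  rw [← h3, Matrix.det_succ_row_zero, Fin.sum_univ_castSucc]
  have h4 : ∀ j, (∑ i, w i • M i) j = ∑ i, w i * M i j := fun j => by
    simp [Finset.sum_apply]
  simp only [Matrix.updateRow_self, h4, hw, mul_zero, zero_mul, Finset.sum_const_zero, zero_add,
    Fin.val_last]
  have h5 : ((M.updateRow 0 (∑ i, w i • M i)).submatrix Fin.succ (Fin.last n).succAbove).det
      = 1 := by
    rw [Matrix.det_of_isUpperTriangular]
    · exact Finset.prod_eq_one fun i _ => by simp [Matrix.updateRow_ne, h1]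
    · intro i j hij
      have : j.val < i.val := hij
      simp only [Matrix.submatrix_apply, Fin.succAbove_last]
      rw [Matrix.updateRow_ne (Fin.succ_ne_zero i)]
      exact h2 _ _ (by simpa using this)
  rw [h5, mul_one, ← mul_assoc, ← mul_pow]
  simp

end Hessenberg

section Hessenberg

variable {R : Type*} [CommRing R]

/-- The cofactors of the last column of a Hessenberg matrix with entries `v_{j-i}^{q^i}`. -/
def cofactorSeq (q : ℕ) (v : ℕ → R) : ℕ → R
  | 0 => 1
  | m + 1 => -∑ j : Fin (m + 1), cofactorSeq q v j * v (m + 1 - j) ^ q ^ j.val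

lemma sum_cofactorSeq (q : ℕ) (v : ℕ → R) (hv : v 0 = 1) {m : ℕ} (hm : m ≠ 0) :
    ∑ j ∈ Finset.range (m + 1), cofactorSeq q v j * v (m - j) ^ q ^ j = 0 := by
  obtain ⟨m, rfl⟩ := Nat.exists_eq_succ_of_ne_zero hm
  rw [Finset.sum_range_succ, Finset.sum_range, Nat.sub_self, hv, one_pow, mul_one]
  rw [cofactorSeq]
  ring

/-- If `∑ v_i s^{q^i} = ρ` and `s^{q^h} = -ϖ ρ`, then up to an ideal containing `ρ - x` and the
higher powers of `s`, the element `s` is a combination of the cofactors. -/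
lemma sub_sum_cofactorSeq_mem {q h : ℕ}
    (hfrob : ∀ (a b : R) (j : ℕ), (a + b) ^ q ^ j = a ^ q ^ j + b ^ q ^ j) (hq : 1 < q)
    (hh : 1 ≤ h) (I : Ideal R) (v : ℕ → R) (v0 : v 0 = 1) (vh : v h = 0) {s ϖ x ρ : R}
    (hρ : ∑ i ∈ Finset.range h, v i * s ^ q ^ i = ρ) (hs : s ^ q ^ h = -ϖ * ρ)
    (hI : ∀ i, s ^ q ^ (h + (i + 1)) ∈ I) (hx : ρ - x ∈ I) :
    s - ∑ j ∈ Finset.range h, cofactorSeq q v j * (x ^ q ^ j + ϖ * x * v (h - j) ^ q ^ j) ∈ I := by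
  set w := cofactorSeq q v with hw
  -- `F j i` is the $i$-th term of $w_j\rho^{q^j}$; in it $s$ has exponent $q^{i+j}$, so the terms
  -- are sorted by $i+j$ against $h$.
  let F : ℕ → ℕ → R := fun j i => w j * (v i ^ q ^ j * s ^ q ^ (i + j))
  have hpow : ∀ j, w j * ρ ^ q ^ j = ∑ i ∈ Finset.range h, F j i := by
    intro j
    let φ : R →+ R := AddMonoidHom.mk' (fun a => a ^ q ^ j) fun a b => hfrob a b j
    change w j * φ ρ = _
    rw [← hρ, map_sum, Finset.mul_sum]
    refine Finset.sum_congr rfl fun i _ => ?_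
    simp only [φ, F, AddMonoidHom.mk'_apply]
    rw [mul_pow, ← pow_mul, ← pow_add]
  -- Terms with $i+j=m<h$: the convolution identity for the cofactors kills every diagonal except
  -- $m=0$, which is $s$.
  have hdiag : ∑ j ∈ Finset.range h, ∑ i ∈ Finset.range (h - j), F j i = s := by
    rw [← Finset.sum_range_diag_flip, Finset.sum_eq_single 0]
    · simp [F, hw, cofactorSeq, v0]
    · intro m _ hm0
      have : ∀ j ∈ Finset.range (m + 1), F j (m - j) = w j * v (m - j) ^ q ^ j * s ^ q ^ m := by
        intro j hj
        have : m - j + j = m := Nat.sub_add_cancel (by simpa [Nat.lt_succ_iff] using hj)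
        simp only [F, this, mul_assoc]
      rw [Finset.sum_congr rfl this, ← Finset.sum_mul, sum_cofactorSeq q v v0 hm0, zero_mul]
    · intro h0
      simp at h0
      omega
  have hsplit : ∀ j ∈ Finset.range h, w j * ρ ^ q ^ j = ∑ i ∈ Finset.range (h - j), F j i +
      ∑ i ∈ Finset.range j, F j (h - j + i) := by
    intro j hj
    have : h = h - j + j := (Nat.sub_add_cancel (Finset.mem_range.1 hj).le).symm
    rw [hpow, ← Finset.sum_range_add, ← this]
  -- Terms with $i+j\ge h$: only $i+j=h$ survives modulo `I`. For $j=0$ there are none, matching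
  -- $v_h=0$.
  have hrest : ∀ j ∈ Finset.range h, ∑ i ∈ Finset.range j, F j (h - j + i) -
      w j * v (h - j) ^ q ^ j * s ^ q ^ h ∈ I := by
    intro j hj
    rcases j with _ | j
    · simp [vh]
    · have hj' : j + 1 ≤ h := (Finset.mem_range.1 hj).le
      rw [Finset.sum_range_succ']
      have h1 : F (j + 1) (h - (j + 1) + 0) =
          w (j + 1) * v (h - (j + 1)) ^ q ^ (j + 1) * s ^ q ^ h := by
        simp only [F, add_zero, Nat.sub_add_cancel hj', mul_assoc]
      rw [h1, add_sub_cancel_right]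
      refine sum_mem fun i _ => Ideal.mul_mem_left _ _ (Ideal.mul_mem_left _ _ ?_)
      have : h - (j + 1) + (i + 1) + (j + 1) = h + (i + 1) := by omega
      rw [this]
      exact hI i
  have hpx : ∀ j, ρ ^ q ^ j - x ^ q ^ j ∈ I := by
    intro j
    have := hfrob (ρ - x) x j
    rw [sub_add_cancel] at this
    rw [this, add_sub_cancel_right]
    exact Ideal.pow_mem_of_mem _ hx _ (Nat.pow_pos (by omega))
  have hfin : s - ∑ j ∈ Finset.range h, w j * (x ^ q ^ j + ϖ * x * v (h - j) ^ q ^ j) =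
      ∑ j ∈ Finset.range h, (w j * (ρ ^ q ^ j - x ^ q ^ j)
        - (∑ i ∈ Finset.range j, F j (h - j + i) - w j * v (h - j) ^ q ^ j * s ^ q ^ h)
        + w j * v (h - j) ^ q ^ j * ϖ * (ρ - x)) := by
    nth_rewrite 1 [← hdiag]
    rw [← Finset.sum_sub_distrib]
    refine Finset.sum_congr rfl fun j hj => ?_
    rw [hs]
    linear_combination -hsplit j hj
  rw [hfin]
  exact sum_mem fun j hj => add_mem (sub_mem (Ideal.mul_mem_left _ _ (hpx j)) (hrest j hj))
    (Ideal.mul_mem_left _ _ hx)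

end Hessenberg

lemma splittingField_algebraMap_apply {R K : Type*} [CommSemiring R] [Field K] [Algebra R K]
    (f : K[X]) (r : R) :
    algebraMap R f.SplittingField r = algebraMap K f.SplittingField (algebraMap R K r) :=
  IsScalarTower.algebraMap_apply _ _ _ _

/-! ### Coordinates of the Tate algebra and the pull-back of $[\pi]$ -/

section Tate

variable {k κ : Type*} [Field k] [Fintype k] [Field κ] {h n : ℕ}

lemma toSeries_injective : Function.Injective (TateAlgebra.toSeries (k := k) (κ := κ) (h := h) (n := n)) :=
  Subtype.val_injective

instance : IsDomain (TateAlgebra k κ h n) :=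
  haveI : IsDomain (MvPowerSeries (Fin n) (E₁ k κ h)) := NoZeroDivisors.to_isDomain _
  toSeries_injective.isDomain (TateAlgebra.toSeries (k := k) (κ := κ) (h := h) (n := n))

lemma toSeries_algebraMap_def (f : DefRing κ h) :
    (algebraMap (DefRing κ h) (TateAlgebra k κ h (h - 1)) f).toSeries =
      MvPowerSeries.rescale (fun _ => pi k κ h)
        (MvPowerSeries.map (algebraMap (PowerSeries κ) (E₁ k κ h)) f) := rfl

lemma toSeries_algebraMap (y : E₁ k κ h) :
    (algebraMap (E₁ k κ h) (TateAlgebra k κ h n) y).toSeries = MvPowerSeries.C y := by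
  rw [AlgHom.commutes]; rfl

lemma rescale_C {σ R : Type*} [CommSemiring R] (a : σ → R) (c : R) :
    MvPowerSeries.rescale a (MvPowerSeries.C c) = MvPowerSeries.C c := by
  classical
  ext m
  rw [MvPowerSeries.coeff_rescale, MvPowerSeries.coeff_C]
  split_ifs with hm <;> simp [hm]

lemma rescale_X {σ R : Type*} [CommSemiring R] (a : σ → R) (i : σ) :
    MvPowerSeries.rescale a (MvPowerSeries.X i) = MvPowerSeries.C (a i) * MvPowerSeries.X i := by
  classical
  ext m
  rw [MvPowerSeries.coeff_rescale, MvPowerSeries.coeff_C_mul, MvPowerSeries.coeff_X]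
  split_ifs with hm <;> simp [hm]

lemma toSeries_V (i : Fin (h - 1)) : (V k κ h i).toSeries = MvPowerSeries.X i := by
  rw [V, map_smul, toSeries_algebraMap_def, MvPowerSeries.map_X, rescale_X,
    MvPowerSeries.smul_eq_C_mul, ← mul_assoc, ← map_mul, inv_mul_cancel₀ (pi_ne_zero k κ h),
    map_one, one_mul]

lemma algebraMap_def_X (i : Fin (h - 1)) :
    algebraMap (DefRing κ h) (TateAlgebra k κ h (h - 1)) (MvPowerSeries.X i) =
      algebraMap _ _ (pi k κ h) * V k κ h i := by
  apply toSeries_injective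
  rw [map_mul, toSeries_V, toSeries_algebraMap_def, MvPowerSeries.map_X, rescale_X,
    toSeries_algebraMap]

lemma algebraMap_def_C (c : PowerSeries κ) :
    algebraMap (DefRing κ h) (TateAlgebra k κ h (h - 1)) (MvPowerSeries.C c) =
      algebraMap (E₁ k κ h) _ (algebraMap (PowerSeries κ) (E₁ k κ h) c) := by
  apply toSeries_injective
  rw [toSeries_algebraMap_def, MvPowerSeries.map_C, rescale_C, toSeries_algebraMap]

lemma isUnit_algebraMap_pi : IsUnit (algebraMap (E₁ k κ h) (TateAlgebra k κ h n) (pi k κ h)) :=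
  (pi_ne_zero k κ h).isUnit.map _

lemma map_univPi :
    (univPi k κ h).map (algebraMap (DefRing κ h) (TateAlgebra k κ h (h - 1))) =
      piPoly (Fintype.card k) h (algebraMap (E₁ k κ h) _ (pi k κ h))
        (fun i => algebraMap (E₁ k κ h) _ (pi k κ h) * V k κ h i) := by
  rw [univPi, map_piPoly, algebraMap_def_C]
  simp_rw [algebraMap_def_X]
  rfl

variable [Algebra k κ]

instance : Algebra k (TateAlgebra k κ h n) :=
  ((algebraMap (E₁ k κ h) (TateAlgebra k κ h n)).comp (algebraMap k (E₁ k κ h))).toAlgebra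

instance : IsScalarTower k (E₁ k κ h) (TateAlgebra k κ h n) :=
  IsScalarTower.of_algebraMap_eq fun _ => rfl

instance : IsScalarTower k (PowerSeries κ) (E₁ k κ h) := by
  refine IsScalarTower.of_algebraMap_eq fun c => ?_
  exact (splittingField_algebraMap_apply _ _).trans
    ((splittingField_algebraMap_apply _ _).trans rfl).symm

instance : IsScalarTower k (DefRing κ h) (TateAlgebra k κ h (h - 1)) := by
  refine IsScalarTower.of_algebraMap_eq fun c => ?_
  have h1 : algebraMap k (DefRing κ h) c =
      MvPowerSeries.C (algebraMap k (PowerSeries κ) c) :=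
    MvPowerSeries.algebraMap_apply
  rw [h1, algebraMap_def_C, ← IsScalarTower.algebraMap_apply k (PowerSeries κ) (E₁ k κ h)]
  rfl

end Tate

/-- Splitting off the trivial root serves twice: the cofactor has constant term $\varpi$, which
gives both the uniqueness of roots with given value at the origin and the invertibility of nonzero
roots. -/
lemma piMap_eq_mul (k : Type*) [Field k] [Fintype k] {R : Type*} [CommRing R] [Algebra k R]
    (h : ℕ) (ϖ : R) (u : Fin (h - 1) → R) (a : R) :
    piMap k h ϖ u a = a * (ϖ + (∑ i, u i * a ^ (Fintype.card k ^ (i.val + 1) - 1) +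
      a ^ (Fintype.card k ^ h - 1))) := by
  have h1 : ∀ j, a * a ^ (Fintype.card k ^ j - 1) = a ^ Fintype.card k ^ j := fun j =>
    mul_pow_sub_one (Nat.pow_pos Fintype.card_pos).ne' a
  rw [piMap_apply, ← h1 h, mul_add, mul_add, Finset.mul_sum, mul_comm ϖ a, ← add_assoc]
  congr 2
  refine Finset.sum_congr rfl fun i _ => ?_
  rw [← h1 (i.val + 1)]
  ring

section Tate

variable {k κ : Type*} [Field k] [Fintype k] [Field κ] {h : ℕ}

/-- Evaluation of functions at the origin of the polydisc, i.e. at the point `x^{(0)}`. -/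
def evalZero (n : ℕ) : TateAlgebra k κ h n →ₐ[E₁ k κ h] E₁ k κ h :=
  { (MvPowerSeries.constantCoeff (σ := Fin n) (R := E₁ k κ h)).comp
      (TateAlgebra.toSeries (k := k) (κ := κ) (h := h) (n := n)).toRingHom with
    commutes' := fun y => by
      change MvPowerSeries.constantCoeff (TateAlgebra.toSeries
        (algebraMap (E₁ k κ h) (TateAlgebra k κ h n) y)) = y
      rw [toSeries_algebraMap, MvPowerSeries.constantCoeff_C] }

lemma evalZero_apply {n : ℕ} (f : TateAlgebra k κ h n) :
    evalZero n f = MvPowerSeries.constantCoeff f.toSeries := rfl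

lemma evalZero_V (i : Fin (h - 1)) : evalZero (h - 1) (V k κ h i) = 0 := by
  rw [evalZero_apply, toSeries_V, MvPowerSeries.constantCoeff_X]

variable [Algebra k κ]

variable (k κ h) in
/-- Multiplication by `π` in the pull-back of `𝓕^univ` to the polydisc `𝔛(1)¹ ⊗ E₁`. -/
def tatePi : TateAlgebra k κ h (h - 1) →ₗ[k] TateAlgebra k κ h (h - 1) :=
  piMap k h (algebraMap (E₁ k κ h) _ (pi k κ h))
    (fun i => algebraMap (E₁ k κ h) _ (pi k κ h) * V k κ h i)

lemma eval_map_univPi (a : TateAlgebra k κ h (h - 1)) :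
    ((univPi k κ h).map (algebraMap (DefRing κ h) (TateAlgebra k κ h (h - 1)))).eval a =
      tatePi k κ h a := by
  rw [map_univPi, eval_piPoly, tatePi]

lemma mem_torsion {x : E₁ k κ h} :
    x ∈ torsion k κ h ↔ x ^ Fintype.card k ^ h = -(pi k κ h * x) := by
  change aeval x (specialPi k κ h) = 0 ↔ _
  rw [aeval_specialPi, add_comm, add_eq_zero_iff_eq_neg]

lemma torsion_pow (x : torsion k κ h) :
    (x : E₁ k κ h) ^ Fintype.card k ^ h = -(pi k κ h * x) :=
  mem_torsion.1 x.2

variable [NeZero h]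

/-- In a domain one of the two factors of `piMap_eq_mul` vanishes. It cannot be the second one,
whose value at the origin is $\pi\ne0$. -/
lemma eq_zero_of_tatePi_eq_zero {D : TateAlgebra k κ h (h - 1)} (hD : tatePi k κ h D = 0)
    (h0 : evalZero _ D = 0) : D = 0 := by
  rw [tatePi, piMap_eq_mul] at hD
  refine (mul_eq_zero.1 hD).resolve_right fun h1 => pi_ne_zero k κ h ?_
  have hq : ∀ j, j ≠ 0 → Fintype.card k ^ j - 1 ≠ 0 := fun j hj =>
    (Nat.sub_pos_of_lt (Nat.one_lt_pow hj Fintype.one_lt_card)).ne'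
  simpa [h0, evalZero_V, hq, NeZero.ne h] using congrArg (evalZero (h - 1)) h1

lemma eq_of_tatePi_eq_zero {a b : TateAlgebra k κ h (h - 1)} (ha : tatePi k κ h a = 0)
    (hb : tatePi k κ h b = 0) (h0 : evalZero _ a = evalZero _ b) : a = b :=
  sub_eq_zero.1 (eq_zero_of_tatePi_eq_zero (by rw [map_sub, ha, hb, sub_zero])
    (by rw [map_sub, h0, sub_self]))

/-- Once $s$ is cancelled, the equation exhibits $\pi$, a unit of the Tate algebra, as a multiple of
$s$. -/
lemma isUnit_of_tatePi_eq_zero {s : TateAlgebra k κ h (h - 1)} (hs : tatePi k κ h s = 0)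
    (h0 : s ≠ 0) : IsUnit s := by
  rw [tatePi, piMap_eq_mul] at hs
  have h1 := eq_neg_of_add_eq_zero_left ((mul_eq_zero.1 hs).resolve_left h0)
  have hq : ∀ j, j ≠ 0 → Fintype.card k ^ j - 1 ≠ 0 := fun j hj =>
    (Nat.sub_pos_of_lt (Nat.one_lt_pow hj Fintype.one_lt_card)).ne'
  refine isUnit_of_dvd_unit ?_ (isUnit_algebraMap_pi (k := k) (κ := κ) (h := h) (n := h - 1))
  rw [h1]
  refine (dvd_add (Finset.dvd_sum fun i _ => Dvd.dvd.mul_left ?_ _) ?_).neg_right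
  · exact dvd_pow_self _ (hq _ (Nat.succ_ne_zero _))
  · exact dvd_pow_self _ (hq _ (NeZero.ne h))

lemma torsion_mem_integers (x : torsion k κ h) : (x : E₁ k κ h) ∈ integers k κ h := by
  refine ⟨piPoly (Fintype.card k) h PowerSeries.X 0,
    monic_piPoly Fintype.one_lt_card NeZero.one_le _ _, ?_⟩
  rw [eval₂_eq_eval_map, map_piPoly]
  simp only [piPoly, Pi.zero_apply, map_zero, zero_mul, Finset.sum_const_zero, add_zero, eval_add,
    eval_mul, eval_C, eval_X, eval_pow]
  rw [torsion_pow]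
  exact add_neg_cancel _

omit [NeZero h] in
lemma algebraMap_mem_integers (c : k) : algebraMap k (E₁ k κ h) c ∈ integers k κ h := by
  rw [IsScalarTower.algebraMap_apply k (PowerSeries κ) (E₁ k κ h)]
  exact (integralClosure (PowerSeries κ) (E₁ k κ h)).algebraMap_mem _

-- For $x\ne0$ this is $x^{q^h-1}=-\pi$; keeping one extra factor $x$ covers $x=0$ as well.
omit [NeZero h] in
lemma torsion_mul_pow (x : torsion k κ h) (N : ℕ) :
    (x : E₁ k κ h) * (x : E₁ k κ h) ^ ((Fintype.card k ^ h - 1) * N) = (-pi k κ h) ^ N * x := by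
  induction N with
  | zero => simp
  | succ N ih =>
    rw [Nat.mul_succ, pow_add, ← mul_assoc, ih, mul_assoc,
      mul_pow_sub_one (Nat.pow_pos Fintype.card_pos).ne', torsion_pow]
    ring

variable (k h) in
/-- A solution of `G = G^{q^h} - ∑ W_i (1 + G^{q^i})` in power series over `k`. -/
def rootSeries : MvPowerSeries (Fin (h - 1)) k :=
  (exists_rootSeries k (NeZero.one_le (n := h))).choose

lemma constantCoeff_rootSeries : MvPowerSeries.constantCoeff (rootSeries k h) = 0 :=
  (exists_rootSeries k (NeZero.one_le (n := h))).choose_spec.1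

lemma rootSeries_eq :
    rootSeries k h + ∑ i, MvPowerSeries.X i * (1 + rootSeries k h ^ Fintype.card k ^ (i.val + 1)) =
      rootSeries k h ^ Fintype.card k ^ h :=
  (exists_rootSeries k (NeZero.one_le (n := h))).choose_spec.2

/-- The series `G(x^{q-1} V_1, x^{q²-1} V_2, …)`. -/
def scaledRootSeries (x : E₁ k κ h) : MvPowerSeries (Fin (h - 1)) (E₁ k κ h) :=
  MvPowerSeries.rescale (fun i => x ^ (Fintype.card k ^ (i.val + 1) - 1))
    (MvPowerSeries.map (algebraMap k (E₁ k κ h)) (rootSeries k h))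

lemma scaledRootSeries_eq (x : E₁ k κ h) :
    scaledRootSeries x + ∑ i : Fin (h - 1),
      MvPowerSeries.C (x ^ (Fintype.card k ^ (i.val + 1) - 1)) * MvPowerSeries.X i *
        (1 + scaledRootSeries x ^ Fintype.card k ^ (i.val + 1)) =
      scaledRootSeries x ^ Fintype.card k ^ h := by
  have := congrArg (fun f => MvPowerSeries.rescale
    (fun i : Fin (h - 1) => x ^ (Fintype.card k ^ (i.val + 1) - 1))
    (MvPowerSeries.map (algebraMap k (E₁ k κ h)) f)) (rootSeries_eq (k := k) (h := h))
  simpa only [scaledRootSeries, map_add, map_sum, map_mul, map_pow, map_one, MvPowerSeries.map_X,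
    rescale_X] using this

/-- The exponent of `x` in the coefficients of `scaledRootSeries x`. -/
def rootWeight (q : ℕ) {n : ℕ} (m : Fin n →₀ ℕ) : ℕ :=
  m.sum fun i c => (q ^ (i.val + 1) - 1) * c

/-- A bound linear in the degree forces the coefficients of `torsionSeries` to tend to zero. In
degree at least $1$ it also gives the exponent in $s\equiv x \pmod{x^q}$. -/
lemma le_rootWeight (q : ℕ) {n : ℕ} (m : Fin n →₀ ℕ) :
    (q - 1) * m.degree ≤ rootWeight q m := by
  rw [rootWeight, Finsupp.degree_apply, Finsupp.sum, Finset.mul_sum]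
  refine Finset.sum_le_sum fun i _ => Nat.mul_le_mul_right _ (Nat.sub_le_sub_right ?_ _)
  exact Nat.le_self_pow (Nat.succ_ne_zero _) q

lemma coeff_scaledRootSeries (x : E₁ k κ h) (m : Fin (h - 1) →₀ ℕ) :
    MvPowerSeries.coeff m (scaledRootSeries x) = x ^ rootWeight (Fintype.card k) m *
      algebraMap k (E₁ k κ h) (MvPowerSeries.coeff m (rootSeries k h)) := by
  rw [scaledRootSeries, MvPowerSeries.coeff_rescale, MvPowerSeries.coeff_map, rootWeight,
    Finsupp.prod, Finsupp.sum, ← Finset.prod_pow_eq_pow_sum]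
  simp_rw [pow_mul]

/-- The series `x (1 + G(x^{q-1} V_1, x^{q²-1} V_2, …))`. -/
def torsionSeries (x : E₁ k κ h) : MvPowerSeries (Fin (h - 1)) (E₁ k κ h) :=
  MvPowerSeries.C x * (1 + scaledRootSeries x)

lemma coeff_zero_torsionSeries (x : E₁ k κ h) :
    MvPowerSeries.coeff 0 (torsionSeries x) = x := by
  rw [torsionSeries, MvPowerSeries.coeff_C_mul, map_add, coeff_scaledRootSeries,
    MvPowerSeries.coeff_zero_eq_constantCoeff_apply, MvPowerSeries.coeff_zero_eq_constantCoeff_apply,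
    constantCoeff_rootSeries]
  simp

lemma coeff_torsionSeries (x : E₁ k κ h) {m : Fin (h - 1) →₀ ℕ} (hm : m ≠ 0) :
    MvPowerSeries.coeff m (torsionSeries x) = x * (x ^ rootWeight (Fintype.card k) m *
      algebraMap k (E₁ k κ h) (MvPowerSeries.coeff m (rootSeries k h))) := by
  classical
  rw [torsionSeries, MvPowerSeries.coeff_C_mul, map_add, coeff_scaledRootSeries,
    MvPowerSeries.coeff_one, if_neg hm, zero_add]

lemma torsionSeries_mem (x : torsion k κ h) :
    torsionSeries (x : E₁ k κ h) ∈ tateSubalgebra k κ h (h - 1) := by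
  intro N
  -- Each block of $q^h-1$ factors $x$ is worth one factor $\pi$ up to sign, so the finitely many
  -- monomials of degree at most $(q^h-1)N$ are the only possible exceptions.
  refine (Finsupp.finite_of_degree_le ((Fintype.card k ^ h - 1) * N)).subset fun m hm => ?_
  by_contra hcon
  refine hm ?_
  have hdeg : (Fintype.card k ^ h - 1) * N < m.degree := not_le.1 hcon
  have hm0 : m ≠ 0 := by
    rintro rfl
    simp at hdeg
  have hle : (Fintype.card k ^ h - 1) * N ≤ rootWeight (Fintype.card k) m :=
    hdeg.le.trans ((Nat.le_mul_of_pos_left _ (Nat.sub_pos_of_lt Fintype.one_lt_card)).trans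
      (le_rootWeight _ m))
  obtain ⟨d, hd⟩ := Nat.exists_eq_add_of_le hle
  refine ⟨(-1) ^ N * x * x ^ d *
    algebraMap k (E₁ k κ h) (MvPowerSeries.coeff m (rootSeries k h)), ?_, ?_⟩
  · exact mul_mem (mul_mem (mul_mem (pow_mem (neg_mem (one_mem _)) _) (torsion_mem_integers x))
      (pow_mem (torsion_mem_integers x) _)) (algebraMap_mem_integers _)
  · rw [coeff_torsionSeries _ hm0, hd, pow_add, ← mul_assoc, ← mul_assoc, torsion_mul_pow,
      neg_pow]
    ring

/-- The root of `[π]` on the polydisc `𝔛(1)¹ ⊗ E₁` which specializes to the root `x` of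
`[π]_{𝓕₀}` at `x^{(0)}`. -/
def torsionFun (x : torsion k κ h) : TateAlgebra k κ h (h - 1) :=
  ⟨torsionSeries (x : E₁ k κ h), torsionSeries_mem x⟩

lemma toSeries_torsionFun (x : torsion k κ h) :
    (torsionFun x).toSeries = torsionSeries (x : E₁ k κ h) := rfl

lemma evalZero_torsionFun (x : torsion k κ h) : evalZero _ (torsionFun x) = (x : E₁ k κ h) := by
  rw [evalZero_apply, toSeries_torsionFun, ← MvPowerSeries.coeff_zero_eq_constantCoeff_apply,
    coeff_zero_torsionSeries]

/-- By additivity of Frobenius and $x^{q^h}=-\pi x$, the left side is $\pi x$ times the defining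
equation of `scaledRootSeries`. -/
lemma tatePi_torsionFun (x : torsion k κ h) : tatePi k κ h (torsionFun x) = 0 := by
  apply toSeries_injective
  simp only [tatePi, piMap_apply, map_add, map_mul, map_sum, map_pow, map_zero, toSeries_V,
    toSeries_algebraMap, toSeries_torsionFun, torsionSeries]
  have hfrob : ∀ j, (MvPowerSeries.C (x : E₁ k κ h) * (1 + scaledRootSeries (x : E₁ k κ h))) ^
      Fintype.card k ^ j = MvPowerSeries.C ((x : E₁ k κ h) ^ Fintype.card k ^ j) *
        (1 + scaledRootSeries (x : E₁ k κ h) ^ Fintype.card k ^ j) := by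
    intro j
    rw [mul_pow, ← frobPow_apply k j (1 + _), map_add, map_one, frobPow_apply, map_pow]
  have hsum : ∑ i : Fin (h - 1), MvPowerSeries.C (pi k κ h) * MvPowerSeries.X i *
      (MvPowerSeries.C (x : E₁ k κ h) * (1 + scaledRootSeries (x : E₁ k κ h))) ^
        Fintype.card k ^ (i.val + 1) =
      MvPowerSeries.C (pi k κ h) * MvPowerSeries.C (x : E₁ k κ h) * ∑ i : Fin (h - 1),
      MvPowerSeries.C ((x : E₁ k κ h) ^ (Fintype.card k ^ (i.val + 1) - 1)) * MvPowerSeries.X i *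
        (1 + scaledRootSeries (x : E₁ k κ h) ^ Fintype.card k ^ (i.val + 1)) := by
    rw [Finset.mul_sum]
    refine Finset.sum_congr rfl fun i _ => ?_
    rw [hfrob, ← mul_pow_sub_one (Nat.pow_pos Fintype.card_pos).ne' (x : E₁ k κ h), map_mul]
    ring
  rw [hsum, hfrob, torsion_pow, map_neg, map_mul, ← scaledRootSeries_eq]
  ring

variable (k κ h) in
/-- The map `x ↦ torsionFun x`, as a `k`-linear map. -/
def torsionLift : torsion k κ h →ₗ[k] TateAlgebra k κ h (h - 1) where
  toFun := torsionFun
  -- Linearity follows from uniqueness: both sides are roots of $[\pi]$ with the same value at the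
  -- origin.
  map_add' x y := eq_of_tatePi_eq_zero (tatePi_torsionFun _)
    (by rw [map_add, tatePi_torsionFun, tatePi_torsionFun, add_zero])
    (by rw [map_add]; simp only [evalZero_torsionFun, Submodule.coe_add])
  map_smul' c x := eq_of_tatePi_eq_zero (tatePi_torsionFun _)
    (by rw [map_smul, tatePi_torsionFun, smul_zero])
    (by
      rw [RingHom.id_apply, ← algebraMap_smul (E₁ k κ h) c (torsionFun x), map_smul,
        evalZero_torsionFun, evalZero_torsionFun, algebraMap_smul, Submodule.coe_smul])

lemma torsionLift_apply (x : torsion k κ h) : torsionLift k κ h x = torsionFun x := rfl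

lemma isUnit_torsionLift {x : torsion k κ h} (hx : x ≠ 0) : IsUnit (torsionLift k κ h x) := by
  refine isUnit_of_tatePi_eq_zero (tatePi_torsionFun x) fun h0 => hx (Subtype.ext ?_)
  have := congrArg (evalZero (h - 1)) h0
  rwa [torsionLift_apply, evalZero_torsionFun, map_zero] at this

lemma isUnit_torsionLift_sub {x y : torsion k κ h} (hxy : x ≠ y) :
    IsUnit (torsionLift k κ h x - torsionLift k κ h y) := by
  rw [← map_sub]
  exact isUnit_torsionLift (sub_ne_zero.2 hxy)

lemma torsionLift_injective : Function.Injective (torsionLift k κ h) := fun x y hxy => by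
  by_contra hne
  exact (isUnit_torsionLift_sub hne).ne_zero (sub_eq_zero.2 hxy)

end Tate

/-! ### Lagrange interpolation at nodes with unit differences -/

section Interpolation

variable {R ι : Type*} [CommRing R] [Fintype ι] [DecidableEq ι]

/-- The Lagrange interpolation polynomials for nodes whose differences are units. -/
def nodalBasis (s : ι → R) (i : ι) : R[X] :=
  ∏ j ∈ Finset.univ.erase i, C (Ring.inverse (s i - s j)) * (X - C (s j))

lemma eval_nodalBasis_self {s : ι → R} (hs : ∀ i j, i ≠ j → IsUnit (s i - s j)) (i : ι) :
    (nodalBasis s i).eval (s i) = 1 := by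
  rw [nodalBasis, eval_prod]
  refine Finset.prod_eq_one fun j hj => ?_
  rw [eval_mul, eval_C, eval_sub, eval_X, eval_C]
  exact Ring.inverse_mul_cancel _ (hs i j (Finset.ne_of_mem_erase hj).symm)

lemma eval_nodalBasis_of_ne (s : ι → R) {i j : ι} (hij : i ≠ j) :
    (nodalBasis s i).eval (s j) = 0 := by
  rw [nodalBasis, eval_prod]
  refine Finset.prod_eq_zero (Finset.mem_erase.2 ⟨hij.symm, Finset.mem_univ j⟩) ?_
  simp

lemma sub_mul_nodalBasis (s : ι → R) (i : ι) :
    (X - C (s i)) * nodalBasis s i = C (∏ j ∈ Finset.univ.erase i, Ring.inverse (s i - s j)) *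
      ∏ j, (X - C (s j)) := by
  rw [nodalBasis, Finset.prod_mul_distrib, map_prod,
    ← Finset.mul_prod_erase Finset.univ (fun j => X - C (s j)) (Finset.mem_univ i)]
  ring

/-- The sum has degree less than the number of nodes and takes the value $1$ at each of them. -/
lemma sum_nodalBasis [IsDomain R] [Nonempty ι] {s : ι → R}
    (hs : ∀ i j, i ≠ j → IsUnit (s i - s j)) : ∑ i, nodalBasis s i = 1 := by
  have hinj : Function.Injective s := fun i j hij => by
    by_contra hne
    exact (hs i j hne).ne_zero (sub_eq_zero.2 hij)
  have hcard : 0 < Fintype.card ι := Fintype.card_pos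
  refine eq_of_degrees_lt_of_eval_index_eq (v := s) Finset.univ hinj.injOn ?_ ?_ fun j _ => ?_
  · refine (degree_sum_le _ _).trans_lt ((Finset.sup_lt_iff (WithBot.bot_lt_coe _)).2 ?_)
    intro i _
    refine (degree_prod_le _ _).trans_lt ?_
    refine (Finset.sum_le_card_nsmul _ _ 1 fun j _ => ?_).trans_lt ?_
    · rw [← smul_eq_C_mul]
      exact (degree_smul_le _ _).trans (degree_X_sub_C_le _)
    · rw [Finset.card_erase_of_mem (Finset.mem_univ i), Finset.card_univ, nsmul_eq_mul, mul_one]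
      exact_mod_cast Nat.sub_lt hcard one_pos
  · rw [degree_one, Finset.card_univ]
    exact_mod_cast hcard
  · rw [eval_finsetSum, Finset.sum_eq_single j, eval_nodalBasis_self hs, eval_one]
    · exact fun i _ hij => eval_nodalBasis_of_ne s hij
    · simp

variable {B ρ : Type*} [CommRing B] [Algebra R B] [Fintype ρ]

/-- The idempotent of `B` cutting out the locus where the elements `b_r` equal the `s_{y_r}`. -/
def nodalIdem (s : ι → R) (b : ρ → B) (y : ρ → ι) : B := ∏ r, aeval (b r) (nodalBasis s (y r))

lemma sum_nodalIdem [IsDomain R] [Nonempty ι] [DecidableEq ρ] {s : ι → R}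
    (hs : ∀ i j, i ≠ j → IsUnit (s i - s j)) (b : ρ → B) :
    ∑ y : ρ → ι, nodalIdem s b y = 1 := by
  refine (Fintype.prod_sum fun r j => aeval (b r) (nodalBasis s j)).symm.trans ?_
  refine Finset.prod_eq_one fun r _ => ?_
  rw [← map_sum, sum_nodalBasis hs, map_one]

/-- Multiplying the $r$-th factor by $b_r-s_{y_r}$ completes it to a multiple of
$\prod_j(b_r-s_j)=0$. -/
lemma mul_nodalIdem [DecidableEq ρ] {s : ι → R} {b : ρ → B}
    (hb : ∀ r, aeval (b r) (∏ j, (X - C (s j))) = 0) (y : ρ → ι) (r : ρ) :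
    b r * nodalIdem s b y = algebraMap R B (s (y r)) * nodalIdem s b y := by
  rw [← sub_eq_zero, ← sub_mul, nodalIdem, ← Finset.mul_prod_erase _ _ (Finset.mem_univ r),
    ← mul_assoc]
  have : b r - algebraMap R B (s (y r)) = aeval (b r) (X - C (s (y r))) := by simp
  rw [this, ← map_mul, sub_mul_nodalBasis, map_mul, hb, mul_zero, zero_mul]

lemma map_nodalIdem {B' : Type*} [CommRing B'] [Algebra R B'] (f : B →ₐ[R] B') (s : ι → R)
    (b : ρ → B) (y : ρ → ι) : f (nodalIdem s b y) = nodalIdem s (fun r => f (b r)) y := by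
  simp only [nodalIdem, map_prod, Polynomial.aeval_algHom_apply]

lemma nodalIdem_nodes_self {s : ι → R} (hs : ∀ i j, i ≠ j → IsUnit (s i - s j)) (y : ρ → ι) :
    nodalIdem s (fun r => s (y r)) y = 1 :=
  Finset.prod_eq_one fun r _ => by
    rw [coe_aeval_eq_eval, eval_nodalBasis_self hs]

lemma nodalIdem_nodes_of_ne (s : ι → R) {y z : ρ → ι} (hyz : y ≠ z) :
    nodalIdem s (fun r => s (z r)) y = 0 := by
  obtain ⟨r, hr⟩ := Function.ne_iff.1 hyz
  refine Finset.prod_eq_zero (Finset.mem_univ r) ?_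
  rw [coe_aeval_eq_eval, eval_nodalBasis_of_ne s hr]

end Interpolation

/-! ### The torsion points and the factorization of $[\pi]$ over the polydisc -/

section Torsion

variable {k κ : Type*} [Field k] [Fintype k] [Field κ] {h : ℕ} [Algebra k κ] [NeZero h]

omit [Algebra k κ] in
lemma monic_specialPi : (specialPi k κ h).Monic :=
  monic_piPoly Fintype.one_lt_card NeZero.one_le _ _

lemma separable_specialPi : (specialPi k κ h).Separable := by
  have hq : ((Fintype.card k : ℕ) : UnrField κ) = 0 := by
    rw [← map_natCast (algebraMap k (UnrField κ)), FiniteField.cast_card_eq_zero, map_zero]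
  rw [separable_def, specialPi, derivative_piPoly hq NeZero.one_le]
  have hX : algebraMap (PowerSeries κ) (UnrField κ) PowerSeries.X ≠ 0 := fun h0 =>
    PowerSeries.X_ne_zero (IsFractionRing.injective (PowerSeries κ) (UnrField κ)
      (h0.trans (map_zero _).symm))
  exact ⟨0, C (algebraMap (PowerSeries κ) (UnrField κ) PowerSeries.X)⁻¹, by
    rw [zero_mul, zero_add, ← C_mul, inv_mul_cancel₀ hX, C_1]⟩

lemma torsion_eq_rootSet :
    (torsion k κ h : Set (E₁ k κ h)) = (specialPi k κ h).rootSet (E₁ k κ h) := by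
  ext y
  rw [mem_rootSet, and_iff_right monic_specialPi.ne_zero]
  rfl

instance : Finite (torsion k κ h) := by
  have : (torsion k κ h : Set (E₁ k κ h)).Finite := by
    rw [torsion_eq_rootSet]
    exact rootSet_finite _ _
  exact this.to_subtype

instance : Fintype (torsion k κ h) := Fintype.ofFinite _

lemma card_torsion : Fintype.card (torsion k κ h) = Fintype.card k ^ h := by
  rw [← natDegree_piPoly (R := UnrField κ) Fintype.one_lt_card NeZero.one_le,
    ← specialPi.eq_1, ← card_rootSet_eq_natDegree separable_specialPi (SplittingField.splits _)]
  exact Fintype.card_congr (Equiv.setCongr torsion_eq_rootSet)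

lemma finrank_torsion : Module.finrank k (torsion k κ h) = h := by
  have := Module.card_eq_pow_finrank (K := k) (V := torsion k κ h)
  rw [card_torsion] at this
  exact (Nat.pow_right_injective Fintype.one_lt_card this).symm

/-- Both sides are monic of degree $q^h$ over a domain and vanish at the $q^h$ distinct elements
`torsionLift k κ h y`. -/
lemma map_univPi_eq_prod :
    (univPi k κ h).map (algebraMap (DefRing κ h) (TateAlgebra k κ h (h - 1))) =
      ∏ y : torsion k κ h, (X - C (torsionLift k κ h y)) := by
  have hm := monic_piPoly (R := TateAlgebra k κ h (h - 1)) (q := Fintype.card k) (h := h)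
    Fintype.one_lt_card NeZero.one_le (algebraMap (E₁ k κ h) _ (pi k κ h))
    (fun i => algebraMap (E₁ k κ h) _ (pi k κ h) * V k κ h i)
  have hd := natDegree_piPoly (R := TateAlgebra k κ h (h - 1)) (q := Fintype.card k) (h := h)
    Fintype.one_lt_card NeZero.one_le (algebraMap (E₁ k κ h) _ (pi k κ h))
    (fun i => algebraMap (E₁ k κ h) _ (pi k κ h) * V k κ h i)
  rw [← map_univPi] at hm hd
  have hm' : (∏ y : torsion k κ h, (X - C (torsionLift k κ h y))).Monic :=
    monic_prod_of_monic _ _ fun _ _ => monic_X_sub_C _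
  have hd' : (∏ y : torsion k κ h, (X - C (torsionLift k κ h y))).natDegree =
      Fintype.card k ^ h := by
    rw [natDegree_prod_of_monic _ _ fun _ _ => monic_X_sub_C _]
    simp_rw [natDegree_X_sub_C]
    simp [card_torsion]
  refine eq_of_degree_le_of_eval_index_eq (v := torsionLift k κ h) Finset.univ
    torsionLift_injective.injOn ?_ ?_ ?_ fun y _ => ?_
  · rw [degree_eq_natDegree hm.ne_zero, hd, Finset.card_univ, card_torsion]
  · rw [degree_eq_natDegree hm.ne_zero, hd, degree_eq_natDegree hm'.ne_zero, hd']
  · rw [hm.leadingCoeff, hm'.leadingCoeff]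
  · rw [eval_map_univPi, torsionLift_apply, tatePi_torsionFun, eval_prod,
      Finset.prod_eq_zero (Finset.mem_univ y)]
    simp [torsionLift_apply]

lemma levelPoly_basis (x : Module.Basis (Fin h) k (torsion k κ h)) :
    levelPoly k (fun r => torsionLift k κ h (x r)) =
      (univPi k κ h).map (algebraMap (DefRing κ h) (TateAlgebra k κ h (h - 1))) := by
  rw [map_univPi_eq_prod, levelPoly]
  refine Fintype.prod_equiv x.equivFun.symm.toEquiv _ _ fun a => ?_
  rw [LinearEquiv.coe_toEquiv, Module.Basis.equivFun_symm_apply, map_sum (torsionLift k κ h)]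
  simp_rw [map_smul]

end Torsion

/-! ### Level structures and the decomposition of the preimage -/

section Level

variable {k κ : Type*} [Field k] [Fintype k] [Field κ] {h : ℕ} [Algebra k κ]
  {R : Type*} [CommRing R] [Algebra k R] [Algebra (DefRing κ h) R] [IsScalarTower k (DefRing κ h) R]

/-- The homomorphism from `𝒜(π)` given by a solution of its defining relations. -/
def levelHom (x : Fin h → R)
    (hx : levelPoly k x = (univPi k κ h).map (algebraMap (DefRing κ h) R)) :
    LevelRing k κ h →ₐ[DefRing κ h] R :=
  Ideal.Quotient.liftₐ (levelIdeal k κ h) (MvPolynomial.aeval x) (by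
    suffices levelIdeal k κ h ≤ RingHom.ker (MvPolynomial.aeval x : _ →ₐ[DefRing κ h] R) from
      fun a ha => this ha
    refine Ideal.span_le.2 ?_
    rintro _ ⟨n, rfl⟩
    change ((MvPolynomial.aeval x : _ →ₐ[DefRing κ h] R) :
      MvPolynomial (Fin h) (DefRing κ h) →+* R) _ = 0
    rw [← coeff_map, Polynomial.map_sub, map_levelPoly, Polynomial.map_map]
    have h1 : ((MvPolynomial.aeval x : _ →ₐ[DefRing κ h] R) :
        MvPolynomial (Fin h) (DefRing κ h) →+* R).comp MvPolynomial.C =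
        algebraMap (DefRing κ h) R := by
      ext1 a
      exact MvPolynomial.aeval_C x a
    have h2 : (fun r => (MvPolynomial.aeval x : _ →ₐ[DefRing κ h] R) (MvPolynomial.X r)) = x := by
      ext r; exact MvPolynomial.aeval_X x r
    rw [h1, h2, hx, sub_self, coeff_zero])

lemma levelHom_levelX (x : Fin h → R)
    (hx : levelPoly k x = (univPi k κ h).map (algebraMap (DefRing κ h) R)) (r : Fin h) :
    levelHom x hx (levelX k κ r) = x r :=
  MvPolynomial.aeval_X x r

lemma levelPoly_of_levelHom (f : LevelRing k κ h →ₐ[DefRing κ h] R) :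
    levelPoly k (fun r => f (levelX k κ r)) = (univPi k κ h).map (algebraMap (DefRing κ h) R) := by
  let g : MvPolynomial (Fin h) (DefRing κ h) →ₐ[DefRing κ h] R :=
    f.comp (Ideal.Quotient.mkₐ (DefRing κ h) (levelIdeal k κ h))
  have h1 : (g : MvPolynomial (Fin h) (DefRing κ h) →+* R).comp MvPolynomial.C =
      algebraMap (DefRing κ h) R := by
    ext1 a
    exact g.commutes a
  have h2 : (fun r => f (levelX k κ r)) = fun r => g (MvPolynomial.X r) := rfl
  rw [h2, ← map_levelPoly, ← h1, ← Polynomial.map_map, ← sub_eq_zero, ← Polynomial.map_sub]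
  ext n
  rw [coeff_map, coeff_zero]
  have : (levelPoly k (fun r => (MvPolynomial.X r : MvPolynomial (Fin h) (DefRing κ h))) -
      (univPi k κ h).map MvPolynomial.C).coeff n ∈ levelIdeal k κ h :=
    Ideal.subset_span ⟨n, rfl⟩
  change f (Ideal.Quotient.mk (levelIdeal k κ h) _) = 0
  rw [Ideal.Quotient.eq_zero_iff_mem.2 this]
  exact map_zero f

end Level

variable {k κ : Type*} [Field k] [Fintype k] [Field κ] {h : ℕ} [Algebra k κ]

lemma eval_levelPoly_self {R : Type*} [CommRing R] [Algebra k R] (x : Fin h → R) (r : Fin h) :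
    (levelPoly k x).eval (x r) = 0 := by
  classical
  rw [levelPoly, eval_prod]
  refine Finset.prod_eq_zero (Finset.mem_univ (Pi.single r 1)) ?_
  simp [Pi.single_apply, ite_smul]

/-- A nontrivial linear combination of the `x_r` divides the linear coefficient. -/
lemma dvd_coeff_one_levelPoly {R : Type*} [CommRing R] [Algebra k R] (x : Fin h → R)
    {a : Fin h → k} (ha : a ≠ 0) : (∑ r, a r • x r) ∣ (levelPoly k x).coeff 1 := by
  classical
  -- The factor for $a=0$ is $X$, so the linear coefficient is the product of the constant terms of
  -- the other factors.
  rw [levelPoly, ← Finset.mul_prod_erase Finset.univ _ (Finset.mem_univ (0 : Fin h → k)),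
    ← Finset.mul_prod_erase _ _ (Finset.mem_erase.2 ⟨ha, Finset.mem_univ a⟩)]
  have h0 : ∑ r, (0 : Fin h → k) r • x r = 0 := by simp
  rw [h0, C_0, sub_zero, coeff_X_mul, mul_coeff_zero, coeff_sub, coeff_X_zero, coeff_C_zero,
    zero_sub]
  exact (dvd_neg.2 dvd_rfl).mul_right _

lemma levelPoly_coordX [NeZero h] :
    levelPoly k (coordX k κ (h := h)) = (∏ y : torsion k κ h, (X - C (torsionLift k κ h y))).map
      (algebraMap (TateAlgebra k κ h (h - 1)) (PreimageRing k κ h)) := by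
  rw [← map_univPi_eq_prod, Polynomial.map_map, ← IsScalarTower.algebraMap_eq]
  exact levelPoly_of_levelHom (Algebra.TensorProduct.includeRight :
    LevelRing k κ h →ₐ[DefRing κ h] PreimageRing k κ h)

variable [NeZero h]

lemma aeval_coordX (r : Fin h) :
    aeval (coordX k κ r) (∏ y : torsion k κ h, (X - C (torsionLift k κ h y))) = 0 := by
  rw [aeval_def, eval₂_eq_eval_map, ← levelPoly_coordX, eval_levelPoly_self]

lemma coeff_one_levelPoly_coordX :
    (levelPoly k (coordX k κ (h := h))).coeff 1 =
      algebraMap (TateAlgebra k κ h (h - 1)) _ (algebraMap (E₁ k κ h) _ (pi k κ h)) := by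
  rw [levelPoly_coordX, ← map_univPi_eq_prod, coeff_map, map_univPi,
    coeff_one_piPoly Fintype.one_lt_card NeZero.one_le]

/-- The section of `𝔛(π) ⊗ E₁ → 𝔛(1)¹ ⊗ E₁` defined by a basis of `𝓕₀[π]`, on functions. -/
def polydiscHom (x : Module.Basis (Fin h) k (torsion k κ h)) :
    PreimageRing k κ h →ₐ[TateAlgebra k κ h (h - 1)] TateAlgebra k κ h (h - 1) :=
  Algebra.TensorProduct.lift (AlgHom.id _ _)
    (levelHom (fun r => torsionLift k κ h (x r)) (levelPoly_basis x)) fun _ _ => Commute.all _ _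

lemma polydiscHom_coordX (x : Module.Basis (Fin h) k (torsion k κ h)) (r : Fin h) :
    polydiscHom x (coordX k κ r) = torsionLift k κ h (x r) := by
  rw [polydiscHom, coordX, Algebra.TensorProduct.lift_tmul, map_one, one_mul, levelHom_levelX]

open scoped Classical in
/-- The idempotent of the locus in the preimage where `X_r^{(1)} = torsionLift (y r)`. -/
def coordIdem (y : Fin h → torsion k κ h) : PreimageRing k κ h :=
  nodalIdem (torsionLift k κ h) (coordX k κ) y

lemma sum_coordIdem : ∑ y : Fin h → torsion k κ h, coordIdem y = 1 := by
  classical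
  convert! sum_nodalIdem (s := torsionLift k κ h) (fun _ _ => isUnit_torsionLift_sub)
    (coordX k κ (h := h))

lemma coordX_mul_coordIdem (y : Fin h → torsion k κ h) (r : Fin h) :
    coordX k κ r * coordIdem y = algebraMap (TateAlgebra k κ h (h - 1)) _
      (torsionLift k κ h (y r)) * coordIdem y := by
  classical
  exact mul_nodalIdem aeval_coordX y r

lemma polydiscHom_coordIdem_self (x : Module.Basis (Fin h) k (torsion k κ h)) :
    polydiscHom x (coordIdem x) = 1 := by
  classical
  rw [coordIdem, map_nodalIdem]
  simp_rw [polydiscHom_coordX]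
  exact nodalIdem_nodes_self (fun _ _ => isUnit_torsionLift_sub) _

lemma polydiscHom_coordIdem_of_ne (x : Module.Basis (Fin h) k (torsion k κ h))
    {y : Fin h → torsion k κ h} (hy : y ≠ x) : polydiscHom x (coordIdem y) = 0 := by
  classical
  rw [coordIdem, map_nodalIdem]
  simp_rw [polydiscHom_coordX]
  exact nodalIdem_nodes_of_ne _ hy

/-- The elements with this property form a subalgebra over the Tate algebra. It contains the
coordinates $X_r^{(1)}$, which generate the preimage ring. -/
lemma exists_mul_coordIdem_eq (y : Fin h → torsion k κ h) (f : PreimageRing k κ h) :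
    ∃ t : TateAlgebra k κ h (h - 1), f * coordIdem y = algebraMap _ _ t * coordIdem y := by
  let S : Subalgebra (TateAlgebra k κ h (h - 1)) (PreimageRing k κ h) :=
    { carrier := {f | ∃ t : TateAlgebra k κ h (h - 1),
        f * coordIdem y = algebraMap _ _ t * coordIdem y}
      mul_mem' := by
        rintro a b ⟨s, hs⟩ ⟨t, ht⟩
        exact ⟨s * t, by rw [mul_assoc, ht, mul_left_comm, hs, map_mul]; ring⟩
      add_mem' := by
        rintro a b ⟨s, hs⟩ ⟨t, ht⟩
        exact ⟨s + t, by rw [add_mul, hs, ht, map_add, add_mul]⟩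
      algebraMap_mem' := fun t => ⟨t, rfl⟩ }
  change f ∈ S
  induction f using TensorProduct.induction_on with
  | zero => exact zero_mem S
  | add a b ha hb => exact add_mem ha hb
  | tmul t l =>
    have h1 : t ⊗ₜ[DefRing κ h] l = t • ((1 : TateAlgebra k κ h (h - 1)) ⊗ₜ[DefRing κ h] l) := by
      rw [TensorProduct.smul_tmul', smul_eq_mul, mul_one]
    rw [h1]
    clear h1
    refine S.smul_mem ?_ t
    obtain ⟨p, rfl⟩ := Ideal.Quotient.mk_surjective (I := levelIdeal k κ h) l
    let g : MvPolynomial (Fin h) (DefRing κ h) →ₐ[DefRing κ h] PreimageRing k κ h :=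
      (Algebra.TensorProduct.includeRight :
        LevelRing k κ h →ₐ[DefRing κ h] PreimageRing k κ h).comp
        (Ideal.Quotient.mkₐ (DefRing κ h) (levelIdeal k κ h))
    change g p ∈ S
    induction p using MvPolynomial.induction_on with
    | C a =>
      have : g (MvPolynomial.C a) = algebraMap (TateAlgebra k κ h (h - 1)) _
          (algebraMap (DefRing κ h) _ a) := by
        rw [← IsScalarTower.algebraMap_apply]
        exact g.commutes a
      rw [this]
      exact S.algebraMap_mem _
    | add p p' hp hp' =>
      rw [map_add]
      exact add_mem hp hp'
    | mul_X p r hp =>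
      rw [map_mul]
      exact mul_mem hp ⟨_, coordX_mul_coordIdem y r⟩

/-- A relation $\sum a_r y_r=0$ makes $\sum a_r X_r^{(1)}$ annihilate the idempotent. By the level
structure that combination divides the linear coefficient $\pi$, which is a unit. -/
lemma coordIdem_eq_zero {y : Fin h → torsion k κ h} (hy : ¬ LinearIndependent k y) :
    (coordIdem y : PreimageRing k κ h) = 0 := by
  obtain ⟨a, ha, r, har⟩ := Fintype.not_linearIndependent_iff.1 hy
  obtain ⟨c, hc⟩ := dvd_coeff_one_levelPoly (k := k) (coordX k κ (h := h)) (a := a)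
    fun h0 => har (congrFun h0 r)
  rw [coeff_one_levelPoly_coordX] at hc
  have h1 : (∑ r, a r • coordX k κ r) * coordIdem y = 0 := by
    rw [Finset.sum_mul]
    have : ∀ r, (a r • coordX k κ r) * coordIdem y = algebraMap (TateAlgebra k κ h (h - 1)) _
        (torsionLift k κ h (a r • y r)) * coordIdem y := by
      intro r
      rw [smul_mul_assoc, coordX_mul_coordIdem, map_smul, Algebra.algebraMap_eq_smul_one,
        Algebra.algebraMap_eq_smul_one, smul_assoc]
      simp only [smul_mul_assoc]
    simp_rw [this]
    rw [← Finset.sum_mul, ← map_sum, ← map_sum, ha, map_zero, map_zero, zero_mul]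
  refine ((isUnit_algebraMap_pi (k := k) (κ := κ) (h := h) (n := h - 1)).map
    (algebraMap _ (PreimageRing k κ h))).mul_right_eq_zero.1 ?_
  rw [hc, mul_right_comm, h1, zero_mul]

lemma polydiscHom_mul_coordIdem (x : Module.Basis (Fin h) k (torsion k κ h))
    (f : PreimageRing k κ h) :
    f * coordIdem x = algebraMap _ _ (polydiscHom x f) * coordIdem (x : Fin h → torsion k κ h) := by
  obtain ⟨t, ht⟩ := exists_mul_coordIdem_eq (x : Fin h → torsion k κ h) f
  have := congrArg (polydiscHom x) ht
  rw [map_mul, map_mul, polydiscHom_coordIdem_self, mul_one, mul_one, AlgHom.commutes] at this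
  rw [ht, this]
  rfl

/-- The preimage is the disjoint union of the polydiscs indexed by the bases of `𝓕₀[π]`. -/
lemma polydiscHom_bijective :
    Function.Bijective fun (f : PreimageRing k κ h) (x : Module.Basis (Fin h) k (torsion k κ h)) =>
      polydiscHom x f := by
  classical
  constructor
  · intro f g hfg
    -- Decompose $f-g$ along the idempotents: dependent tuples contribute nothing, and the component
    -- at a basis is determined by its polydisc.
    rw [← sub_eq_zero, ← mul_one (f - g), ← sum_coordIdem, Finset.mul_sum]
    refine Finset.sum_eq_zero fun y _ => ?_
    by_cases hy : LinearIndependent k y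
    · have hb : y = basisOfLinearIndependentOfCardEqFinrank hy (by
          rw [Fintype.card_fin, finrank_torsion]) := by simp
      rw [hb, polydiscHom_mul_coordIdem, map_sub, sub_eq_zero.2 (congrFun hfg _), map_zero,
        zero_mul]
    · rw [coordIdem_eq_zero hy, mul_zero]
  · intro g
    have : Finite (Module.Basis (Fin h) k (torsion k κ h)) :=
      Finite.of_injective (fun x => (x : Fin h → torsion k κ h)) DFunLike.coe_injective
    have := Fintype.ofFinite (Module.Basis (Fin h) k (torsion k κ h))
    refine ⟨∑ x, algebraMap _ _ (g x) * coordIdem x, funext fun x => ?_⟩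
    simp only [map_sum, map_mul]
    rw [Finset.sum_eq_single x, polydiscHom_coordIdem_self, mul_one]
    · exact AlgHom.commutes _ _
    · intro y _ hyx
      rw [polydiscHom_coordIdem_of_ne x fun h0 => hyx (DFunLike.coe_injective h0), mul_zero]
    · simp

/-! ### The points above $x^{(0)}$ -/

section Points

variable {k κ : Type*} [Field k] [Fintype k] [Field κ] {h : ℕ}

/-- The sum of the terms of `f` whose smallest variable is `X_i`, divided by `X_i`. -/
def divSmallestX {R : Type*} [CommRing R] {n : ℕ} (f : MvPowerSeries (Fin n) R) (i : Fin n) :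
    MvPowerSeries (Fin n) R :=
  fun m => if ∀ j < i, m j = 0 then MvPowerSeries.coeff (m + Finsupp.single i 1) f else 0

lemma coeff_divSmallestX {R : Type*} [CommRing R] {n : ℕ} (f : MvPowerSeries (Fin n) R)
    (i : Fin n) (m : Fin n →₀ ℕ) : MvPowerSeries.coeff m (divSmallestX f i) =
      if ∀ j < i, m j = 0 then MvPowerSeries.coeff (m + Finsupp.single i 1) f else 0 := rfl

/-- Each nonconstant monomial has a unique smallest variable, so it is counted exactly once on the
right. -/
lemma eq_sum_X_mul_divSmallestX {R : Type*} [CommRing R] {n : ℕ} {f : MvPowerSeries (Fin n) R}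
    (hf : MvPowerSeries.coeff 0 f = 0) : f = ∑ i, MvPowerSeries.X i * divSmallestX f i := by
  classical
  ext m
  have hc : ∀ i, MvPowerSeries.coeff m (MvPowerSeries.X i * divSmallestX f i) =
      if m i ≠ 0 ∧ ∀ j < i, m j = 0 then MvPowerSeries.coeff m f else 0 := by
    intro i
    rw [MvPowerSeries.X_def, MvPowerSeries.coeff_monomial_mul, one_mul, coeff_divSmallestX]
    by_cases hi : 1 ≤ m i
    · have hle : Finsupp.single i 1 ≤ m := Finsupp.single_le_iff.2 hi
      rw [if_pos hle, tsub_add_cancel_of_le hle]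
      refine if_congr ?_ rfl rfl
      rw [and_iff_right (Nat.one_le_iff_ne_zero.1 hi)]
      refine forall_congr' fun j => imp_congr_right fun hj => ?_
      rw [Finsupp.tsub_apply, Finsupp.single_eq_of_ne hj.ne, tsub_zero]
    · rw [if_neg (fun hle => hi (Finsupp.single_le_iff.1 hle)), if_neg]
      omega
  rw [map_sum]
  simp_rw [hc]
  by_cases hm : m = 0
  · simp [hm, hf]
  · have hne : m.support.Nonempty := Finsupp.support_nonempty_iff.2 hm
    rw [Finset.sum_eq_single (m.support.min' hne), if_pos]
    · refine ⟨Finsupp.mem_support_iff.1 (Finset.min'_mem _ hne), fun j hj => ?_⟩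
      by_contra h0
      exact (Finset.min'_le _ j (Finsupp.mem_support_iff.2 h0)).not_gt hj
    · intro i _ hi
      refine if_neg fun hcon => hi (le_antisymm ?_ ?_)
      · by_contra hlt
        exact Finsupp.mem_support_iff.1 (Finset.min'_mem _ hne) (hcon.2 _ (not_le.1 hlt))
      · exact Finset.min'_le _ i (Finsupp.mem_support_iff.2 hcon.1)
    · simp

/-- Functions vanishing at the origin lie in the ideal of the $V_i$. The coefficients of
`divSmallestX` are zero or shifted coefficients of $f$, so convergence is preserved. -/
lemma exists_eq_sum_V_mul {f : TateAlgebra k κ h (h - 1)} (hf : evalZero _ f = 0) :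
    ∃ g : Fin (h - 1) → TateAlgebra k κ h (h - 1), f = ∑ i, V k κ h i * g i := by
  rw [evalZero_apply, ← MvPowerSeries.coeff_zero_eq_constantCoeff_apply] at hf
  have hmem : ∀ i, divSmallestX f.toSeries i ∈ tateSubalgebra k κ h (h - 1) := by
    intro i N
    refine ((f.2 N).preimage (f := fun m => m + Finsupp.single i 1)
      (add_left_injective _).injOn).subset fun m hm hcon => hm ?_
    by_cases h0 : ∀ j < i, m j = 0
    · obtain ⟨z, hz, hz'⟩ := hcon
      exact ⟨z, hz, (coeff_divSmallestX _ _ _).trans ((if_pos h0).trans hz')⟩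
    · exact ⟨0, zero_mem _,
        (coeff_divSmallestX _ _ _).trans ((if_neg h0).trans (mul_zero _).symm)⟩
  have hlift : ∀ i, ∃ g : TateAlgebra k κ h (h - 1), g.toSeries = divSmallestX f.toSeries i :=
    fun i => ⟨⟨_, hmem i⟩, rfl⟩
  choose g hg using hlift
  refine ⟨g, toSeries_injective ?_⟩
  simp_rw [map_sum, map_mul, toSeries_V, hg]
  exact eq_sum_X_mul_divSmallestX hf

variable [Algebra k κ] [NeZero h]

/-- The value of functions at the point of a polydisc above `x^{(0)}`. -/
def canonicalEval (x : Module.Basis (Fin h) k (torsion k κ h)) :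
    PreimageRing k κ h →+* E₁ k κ h :=
  (evalZero (h - 1)).toRingHom.comp (polydiscHom x).toRingHom

lemma canonicalEval_apply (x : Module.Basis (Fin h) k (torsion k κ h)) (f : PreimageRing k κ h) :
    canonicalEval x f = evalZero _ (polydiscHom x f) := rfl

lemma canonicalEval_algebraMap (x : Module.Basis (Fin h) k (torsion k κ h)) (y : E₁ k κ h) :
    canonicalEval x (algebraMap _ _ y) = y := by
  rw [canonicalEval_apply, IsScalarTower.algebraMap_apply (E₁ k κ h)
    (TateAlgebra k κ h (h - 1)) (PreimageRing k κ h), AlgHom.commutes]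
  exact AlgHom.commutes _ _

/-- The point above `x^{(0)}` of the polydisc attached to a basis. -/
def canonicalPoint (x : Module.Basis (Fin h) k (torsion k κ h)) :
    MaximalSpectrum (PreimageRing k κ h) :=
  ⟨RingHom.ker (canonicalEval x), RingHom.ker_isMaximal_of_surjective _ fun y =>
    ⟨_, canonicalEval_algebraMap x y⟩⟩

lemma mem_canonicalPoint {x : Module.Basis (Fin h) k (torsion k κ h)} {f : PreimageRing k κ h} :
    f ∈ (canonicalPoint x).asIdeal ↔ evalZero _ (polydiscHom x f) = 0 := Iff.rfl

lemma canonicalPoint_mem_polydisc (x : Module.Basis (Fin h) k (torsion k κ h)) :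
    canonicalPoint x ∈ polydisc (polydiscHom x) := fun f hf => by
  rw [mem_canonicalPoint, RingHom.mem_ker.1 hf, map_zero]

lemma isAboveSpecial_canonicalPoint (x : Module.Basis (Fin h) k (torsion k κ h)) :
    IsAboveSpecial (canonicalPoint x) := fun i => by
  rw [mem_canonicalPoint, AlgHom.commutes]
  exact evalZero_V i

lemma hasCoordinates_canonicalPoint (x : Module.Basis (Fin h) k (torsion k κ h)) :
    HasCoordinates (canonicalPoint x) fun r => (x r : E₁ k κ h) := fun r => by
  change canonicalEval x _ = 0
  rw [map_sub, canonicalEval_algebraMap, canonicalEval_apply, polydiscHom_coordX,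
    torsionLift_apply, evalZero_torsionFun, sub_self]

/-- Modulo the kernel of the section, $f$ equals its restriction to the polydisc. If that
restriction vanishes at the origin it lies in the ideal of the $V_i$, hence in `m`; maximality turns
this inclusion into equality. -/
lemma eq_canonicalPoint {x : Module.Basis (Fin h) k (torsion k κ h)}
    {m : MaximalSpectrum (PreimageRing k κ h)} (hm : m ∈ polydisc (polydiscHom x))
    (hm' : IsAboveSpecial m) : m = canonicalPoint x := by
  refine MaximalSpectrum.ext
    ((canonicalPoint x).isMaximal.eq_of_le m.isMaximal.ne_top fun f hf => ?_).symm
  obtain ⟨g, hg⟩ := exists_eq_sum_V_mul (mem_canonicalPoint.1 hf)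
  have h1 : f - algebraMap _ _ (polydiscHom x f) ∈ m.asIdeal := hm (by
    rw [RingHom.mem_ker, map_sub, AlgHom.commutes]
    exact sub_self _)
  rw [← sub_add_cancel f (algebraMap _ _ (polydiscHom x f))]
  refine add_mem h1 ?_
  rw [hg, map_sum]
  refine sum_mem fun i _ => ?_
  rw [map_mul]
  exact Ideal.mul_mem_right _ _ (hm' i)

end Points

lemma map_cofactorSeq {R S : Type*} [CommRing R] [CommRing S] (f : R →+* S) (q : ℕ) (v : ℕ → R)
    (m : ℕ) : f (cofactorSeq q v m) = cofactorSeq q (fun j => f (v j)) m := by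
  induction m using Nat.strong_induction_on with
  | _ m ih =>
    rcases m with _ | m
    · rw [cofactorSeq, cofactorSeq, map_one]
    · rw [cofactorSeq, cofactorSeq, map_neg, map_sum]
      refine congrArg _ (Finset.sum_congr rfl fun j _ => ?_)
      rw [map_mul, map_pow, ih j j.2]

/-! ### Expansion of the determinant -/

section Determinant

variable {k κ : Type*} [Field k] [Fintype k] [Field κ] {h : ℕ}

lemma Vnat_zero : Vnat k κ h 0 = 1 := if_pos rfl

lemma Vnat_succ (i : Fin (h - 1)) : Vnat k κ h (i.val + 1) = V k κ h i := by
  rw [Vnat, if_neg (Nat.succ_ne_zero _), dif_pos (by simp)]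
  rfl

lemma Vnat_self (hh : 1 ≤ h) : Vnat k κ h h = 0 := by
  rw [Vnat, if_neg (by omega), dif_neg (by omega)]

lemma sum_Vnat_mul (hh : 1 ≤ h) (F : ℕ → TateAlgebra k κ h (h - 1)) :
    ∑ i ∈ Finset.range h, Vnat k κ h i * F i =
      F 0 + ∑ i : Fin (h - 1), V k κ h i * F (i.val + 1) := by
  obtain ⟨n, rfl⟩ : ∃ n, h = n + 1 := ⟨h - 1, by omega⟩
  rw [Finset.sum_range_succ', Vnat_zero, one_mul, add_comm _ (F 0)]
  congr 1
  rw [Finset.sum_range]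
  exact Finset.sum_congr rfl fun i _ => by rw [← Vnat_succ]

lemma neg_one_pow_mul_det_sectionMatrix (hh : 1 ≤ h) (x : E₁ k κ h) :
    (-1) ^ (h - 1) * (sectionMatrix k κ h x).det = ∑ j ∈ Finset.range h,
      cofactorSeq (Fintype.card k) (Vnat k κ h) j *
        (algebraMap (E₁ k κ h) _ x ^ Fintype.card k ^ j +
          algebraMap (E₁ k κ h) _ (pi k κ h) * algebraMap (E₁ k κ h) _ x *
            Vnat k κ h (h - j) ^ Fintype.card k ^ j) := by
  obtain ⟨n, rfl⟩ : ∃ n, h = n + 1 := ⟨h - 1, by omega⟩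
  have hlt : ∀ j : Fin n, j.val + 1 < n + 1 := fun j => by omega
  have hM : ∀ (i : Fin (n + 1)) (j : Fin n), sectionMatrix k κ (n + 1) x i j.castSucc =
      if i.val ≤ j.val + 1 then
        Vnat k κ (n + 1) (j.val + 1 - i.val) ^ Fintype.card k ^ i.val else 0 := by
    intro i j
    rw [sectionMatrix, Matrix.of_apply, Fin.val_castSucc, if_pos (hlt j)]
  refine (neg_one_pow_mul_det_hessenberg (sectionMatrix k κ (n + 1) x)
    (fun i => cofactorSeq (Fintype.card k) (Vnat k κ (n + 1)) i.val) ?_ ?_ ?_ ?_).trans ?_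
  · exact cofactorSeq.eq_1 _ _
  · intro j
    rw [hM, Fin.val_succ, if_pos le_rfl, Nat.sub_self, Vnat_zero, one_pow]
  · intro i j hij
    rw [hM, if_neg (by omega)]
  · intro j
    rw [← sum_cofactorSeq (Fintype.card k) (Vnat k κ (n + 1)) Vnat_zero (Nat.succ_ne_zero j.val)]
    simp_rw [hM]
    rw [Fin.sum_univ_eq_sum_range (fun i => cofactorSeq (Fintype.card k) (Vnat k κ (n + 1)) i *
      if i ≤ j.val + 1 then Vnat k κ (n + 1) (j.val + 1 - i) ^ Fintype.card k ^ i else 0)]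
    symm
    refine Finset.sum_subset_zero_on_sdiff (fun i hi => ?_) (fun i hi => ?_) (fun i hi => ?_)
    · simp only [Finset.mem_range] at hi ⊢
      omega
    · simp only [Finset.mem_sdiff, Finset.mem_range] at hi
      rw [if_neg (by omega), mul_zero]
    · simp only [Finset.mem_range] at hi
      rw [if_pos (by omega)]
  · rw [Finset.sum_range]
    refine Finset.sum_congr rfl fun i _ => ?_
    rw [sectionMatrix, Matrix.of_apply, Fin.val_last, if_neg (lt_irrefl _)]
    by_cases hi : i.val = 0
    -- The top right entry is just $x$; it fits the general formula because $V_h=0$.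
    · rw [if_pos hi, hi, Nat.sub_zero, Vnat_self hh, pow_zero, pow_one, pow_one, mul_zero, add_zero]
    · rw [if_neg hi, map_pow, map_mul]

end Determinant

/-! ### Integrality and the congruence modulo $\pi^{q-1}x^q$ -/

section Congruence

variable {k κ : Type*} [Field k] [Fintype k] [Field κ] {h n : ℕ}

lemma algebraMap_mem_integralTate {y : E₁ k κ h} (hy : y ∈ integers k κ h) :
    algebraMap (E₁ k κ h) (TateAlgebra k κ h n) y ∈ integralTate k κ h n := by
  classical
  intro m
  rw [toSeries_algebraMap, MvPowerSeries.coeff_C]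
  split_ifs
  exacts [hy, zero_mem _]

lemma V_mem_integralTate (i : Fin (h - 1)) : V k κ h i ∈ integralTate k κ h (h - 1) := by
  classical
  intro m
  rw [toSeries_V, MvPowerSeries.coeff_X]
  split_ifs
  exacts [one_mem _, zero_mem _]

lemma Vnat_mem_integralTate (j : ℕ) : Vnat k κ h j ∈ integralTate k κ h (h - 1) := by
  rw [Vnat]
  split_ifs
  exacts [one_mem _, V_mem_integralTate _, zero_mem _]

lemma mem_integralTate_of_coeff {f : TateAlgebra k κ h n} {c : E₁ k κ h} (hc : c ≠ 0)
    (hf : ∀ m, ∃ z ∈ integers k κ h, MvPowerSeries.coeff m f.toSeries = c * z) :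
    ∃ g ∈ integralTate k κ h n, f = algebraMap (E₁ k κ h) _ c * g := by
  refine ⟨algebraMap (E₁ k κ h) _ c⁻¹ * f, fun m => ?_, ?_⟩
  · obtain ⟨z, hz, hz'⟩ := hf m
    rw [map_mul, toSeries_algebraMap, MvPowerSeries.coeff_C_mul, hz', inv_mul_cancel_left₀ hc]
    exact hz
  · rw [← mul_assoc, ← map_mul, mul_inv_cancel₀ hc, map_one, one_mul]

variable [Algebra k κ] [NeZero h]

lemma exists_torsionLift_eq_mul {x : torsion k κ h} (hx : (x : E₁ k κ h) ≠ 0) :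
    ∃ g ∈ integralTate k κ h (h - 1), torsionLift k κ h x = algebraMap _ _ (x : E₁ k κ h) * g := by
  refine mem_integralTate_of_coeff hx fun m => ?_
  rw [torsionLift_apply, toSeries_torsionFun]
  by_cases hm : m = 0
  · exact ⟨1, one_mem _, by rw [hm, coeff_zero_torsionSeries, mul_one]⟩
  · exact ⟨_, mul_mem (pow_mem (torsion_mem_integers x) _) (algebraMap_mem_integers _),
      coeff_torsionSeries _ hm⟩

/-- A nonconstant coefficient carries $x^{1+w}$, where the weight satisfies $w\ge q-1$. -/
lemma exists_torsionLift_sub_eq_mul {x : torsion k κ h} (hx : (x : E₁ k κ h) ≠ 0) :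
    ∃ g ∈ integralTate k κ h (h - 1), torsionLift k κ h x - algebraMap _ _ (x : E₁ k κ h) =
      algebraMap _ _ ((x : E₁ k κ h) ^ Fintype.card k) * g := by
  classical
  refine mem_integralTate_of_coeff (pow_ne_zero _ hx) fun m => ?_
  rw [map_sub, map_sub, torsionLift_apply, toSeries_torsionFun, toSeries_algebraMap,
    MvPowerSeries.coeff_C]
  by_cases hm : m = 0
  · exact ⟨0, zero_mem _, by rw [if_pos hm, hm, coeff_zero_torsionSeries, sub_self, mul_zero]⟩
  · have hle : Fintype.card k - 1 ≤ rootWeight (Fintype.card k) m :=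
      (Nat.le_mul_of_pos_right _ (Nat.pos_of_ne_zero
        ((Finsupp.degree_eq_zero_iff m).not.2 hm))).trans (le_rootWeight _ m)
    obtain ⟨d, hd⟩ := Nat.exists_eq_add_of_le hle
    refine ⟨_, mul_mem (pow_mem (torsion_mem_integers x) d) (algebraMap_mem_integers
      (MvPowerSeries.coeff m (rootSeries k h))), ?_⟩
    rw [if_neg hm, sub_zero, coeff_torsionSeries _ hm, hd, pow_add,
      ← mul_pow_sub_one (Fintype.card_pos (α := k)).ne' (x : E₁ k κ h)]
    ring

/-- The congruence modulo `π^{q-1} x^q` between a torsion point of the universal deformation and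
the determinant. -/
lemma exists_torsionLift_sub_det_eq_mul {x : torsion k κ h} (hx : (x : E₁ k κ h) ≠ 0) :
    torsionLift k κ h x ∈ integralTate k κ h (h - 1) ∧
    (-1) ^ (h - 1) * (sectionMatrix k κ h (x : E₁ k κ h)).det ∈ integralTate k κ h (h - 1) ∧
    ∃ e ∈ integralTate k κ h (h - 1), torsionLift k κ h x -
      (-1) ^ (h - 1) * (sectionMatrix k κ h (x : E₁ k κ h)).det =
        algebraMap (E₁ k κ h) _ (pi k κ h ^ (Fintype.card k - 1) *
          (x : E₁ k κ h) ^ Fintype.card k) * e := by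
  have hh : 1 ≤ h := NeZero.one_le
  set q := Fintype.card k with hq
  have hq1 : 1 < q := Fintype.one_lt_card
  set T := TateAlgebra k κ h (h - 1)
  let A := integralTate k κ h (h - 1)
  let ι : A →+* T := A.subtype
  obtain ⟨y, hy, hsy⟩ := exists_torsionLift_eq_mul hx
  obtain ⟨z, hz, hsz⟩ := exists_torsionLift_sub_eq_mul hx
  set s := torsionLift k κ h x with hs
  let P : A := ⟨algebraMap (E₁ k κ h) T (pi k κ h), algebraMap_mem_integralTate (pi_mem k κ h)⟩
  let ξ : A := ⟨algebraMap (E₁ k κ h) T x, algebraMap_mem_integralTate (torsion_mem_integers x)⟩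
  let Y : A := ⟨y, hy⟩
  let Z : A := ⟨z, hz⟩
  let S : A := ξ * Y
  have hS : ι S = s := hsy.symm
  have hSZ : S - ξ = ξ ^ q * Z := Subtype.ext (by
    change ι S - ι ξ = ι ξ ^ q * z
    rw [hS]
    change s - algebraMap (E₁ k κ h) T x = (algebraMap (E₁ k κ h) T x) ^ q * z
    rw [hsz, map_pow])
  let v : ℕ → A := fun j => ⟨Vnat k κ h j, Vnat_mem_integralTate j⟩
  have hfrob : ∀ (a b : A) (j : ℕ), (a + b) ^ q ^ j = a ^ q ^ j + b ^ q ^ j := fun a b j =>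
    Subtype.ext (by
      change (ι a + ι b) ^ q ^ j = ι a ^ q ^ j + ι b ^ q ^ j
      rw [← frobPow_apply, ← frobPow_apply, ← frobPow_apply, map_add])
  have hξ : ξ ^ q ^ h = -(P * ξ) := Subtype.ext (by
    change (algebraMap (E₁ k κ h) T x) ^ q ^ h =
      -(algebraMap (E₁ k κ h) T (pi k κ h) * algebraMap (E₁ k κ h) T x)
    rw [← map_pow, torsion_pow, map_neg, map_mul])
  let ρ : A := ∑ i ∈ Finset.range h, v i * S ^ q ^ i
  have hP0 : P ≠ 0 := fun h0 =>
    (isUnit_algebraMap_pi (k := k) (κ := κ) (h := h) (n := h - 1)).ne_zero (congrArg ι h0)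
  have hSρ : S ^ q ^ h = -P * ρ := Subtype.ext (by
    have h1 : ι ρ = s + ∑ i : Fin (h - 1), V k κ h i * s ^ q ^ (i.val + 1) := by
      simp only [ρ, map_sum, map_mul, map_pow, hS]
      refine (sum_Vnat_mul hh fun i => s ^ q ^ i).trans ?_
      rw [pow_zero, pow_one]
    have h2 : tatePi k κ h s = 0 := tatePi_torsionFun x
    rw [tatePi, piMap_apply] at h2
    simp_rw [mul_assoc] at h2
    rw [← Finset.mul_sum] at h2
    change ι S ^ q ^ h = -(algebraMap (E₁ k κ h) T (pi k κ h)) * ι ρ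
    rw [h1, hS]
    linear_combination h2)
  -- The modulus: $(-\pi x)^q$ equals $c$ times $\pm\pi$, and the spare $\pi$ is the one cancelled
  -- in `hρ`.
  let c : A := P ^ (q - 1) * ξ ^ q
  have hPξ : (-(P * ξ)) ^ q = c * ((-1) ^ q * P) := by
    rw [neg_pow, mul_pow, ← mul_pow_sub_one (by omega : q ≠ 0) P]
    ring
  have hI : ∀ i, S ^ q ^ (h + (i + 1)) ∈ Ideal.span {c} := by
    intro i
    rw [pow_add q h, pow_mul, mul_pow, hξ, mul_pow, pow_succ' q i, pow_mul, hPξ, mul_pow]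
    refine Ideal.mul_mem_right _ _ (Ideal.mul_mem_right _ _ ?_)
    exact Ideal.pow_mem_of_mem _ (Ideal.mem_span_singleton_self c) _ (Nat.pow_pos (by omega))
  have hρ : ρ - ξ ∈ Ideal.span {c} := by
    have h1 : P * (ρ - ξ) = P * (c * (-(-1) ^ q * Z ^ q ^ h)) := by
      -- Raise $S-\xi=\xi^qZ$ to the power $q^h$: the left side becomes $-P(\rho-\xi)$ and the right
      -- side $(-P\xi)^qZ^{q^h}$.
      have h2 := hfrob (S - ξ) ξ h
      rw [sub_add_cancel, hSρ, hξ, hSZ, mul_pow, ← pow_mul, mul_comm q, pow_mul, hξ, hPξ] at h2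
      linear_combination -h2
    rw [mul_left_cancel₀ hP0 h1]
    exact Ideal.mul_mem_right _ _ (Ideal.mem_span_singleton_self c)
  have hmain := sub_sum_cofactorSeq_mem hfrob hq1 hh (Ideal.span {c}) v
    (Subtype.ext Vnat_zero) (Subtype.ext (Vnat_self hh)) rfl hSρ hI hρ
  obtain ⟨e, he⟩ := Ideal.mem_span_singleton.1 hmain
  have hdet : (-1) ^ (h - 1) * (sectionMatrix k κ h (x : E₁ k κ h)).det =
      ι (∑ j ∈ Finset.range h, cofactorSeq q v j *
        (ξ ^ q ^ j + P * ξ * v (h - j) ^ q ^ j)) := by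
    rw [neg_one_pow_mul_det_sectionMatrix hh, map_sum]
    refine Finset.sum_congr rfl fun j _ => ?_
    rw [map_mul, map_cofactorSeq]
    rfl
  refine ⟨hS ▸ S.2, hdet ▸ Subtype.property _, ι e, e.2, ?_⟩
  have hc : ι c = algebraMap (E₁ k κ h) T (pi k κ h ^ (q - 1) * (x : E₁ k κ h) ^ q) := by
    rw [map_mul (algebraMap (E₁ k κ h) T), map_pow (algebraMap (E₁ k κ h) T),
      map_pow (algebraMap (E₁ k κ h) T)]
    rfl
  rw [hdet, ← hS, ← map_sub, he, map_mul, hc]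

end Congruence

/-! ### The exponent $q-1+q/(q^h-1)$ -/

section Exponent

variable {k κ : Type*} [Field k] [Fintype k] [Field κ] {h : ℕ} [Algebra k κ] [NeZero h]

omit [NeZero h] in
lemma torsion_pow_sub_one {x : torsion k κ h} (hx : (x : E₁ k κ h) ≠ 0) :
    (x : E₁ k κ h) ^ (Fintype.card k ^ h - 1) = -pi k κ h := by
  refine mul_left_cancel₀ hx ?_
  rw [mul_pow_sub_one (Nat.pow_pos Fintype.card_pos).ne', torsion_pow]
  ring

/-- The fraction $((q-1)N+q)/N$ is in lowest terms because $q$ is prime to $N=q^h-1$. `CongrModPi`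
reads off this reduced form. -/
lemma num_den_exponent {q N : ℕ} (hq : 1 < q) (hN : N = q ^ h - 1) :
    ((q : ℚ) - 1 + q / ((q : ℚ) ^ h - 1)).num = ((q - 1) * N + q : ℕ) ∧
      ((q : ℚ) - 1 + q / ((q : ℚ) ^ h - 1)).den = N := by
  have h1 : 1 < q ^ h := Nat.one_lt_pow (NeZero.ne h) hq
  have hN0 : 0 < N := by omega
  have hNq : (N : ℚ) = (q : ℚ) ^ h - 1 := by
    rw [hN, Nat.cast_sub h1.le, Nat.cast_pow, Nat.cast_one]
  have hcop : Nat.Coprime ((q - 1) * N + q) N := by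
    rw [Nat.coprime_mul_right_add_left]
    have h2 : Nat.Coprime (q ^ h) (q ^ h - 1) :=
      (Nat.coprime_self_sub_right h1.le).2 (Nat.coprime_one_right _)
    rw [hN]
    exact Nat.Coprime.coprime_dvd_left (dvd_pow_self q (NeZero.ne h)) h2
  have hα : (q : ℚ) - 1 + q / ((q : ℚ) ^ h - 1) =
      (((q - 1) * N + q : ℕ) : ℤ) / ((N : ℤ) : ℚ) := by
    rw [← hNq]
    have : (N : ℚ) ≠ 0 := by exact_mod_cast hN0.ne'
    push_cast [Nat.cast_sub hq.le]
    field_simp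
  rw [hα]
  exact ⟨Rat.num_div_eq_of_coprime (by exact_mod_cast hN0) hcop, by
    have := Rat.den_div_eq_of_coprime (a := (((q - 1) * N + q : ℕ) : ℤ)) (b := (N : ℤ))
      (by exact_mod_cast hN0) hcop
    exact_mod_cast this⟩

lemma congrModPi_of_sub_eq_mul [IsAlgClosed κ] {x : torsion k κ h} (hx : (x : E₁ k κ h) ≠ 0)
    {n : ℕ} {f g e : TateAlgebra k κ h n} (hf : f ∈ integralTate k κ h n)
    (hg : g ∈ integralTate k κ h n) (he : e ∈ integralTate k κ h n)
    (hfg : f - g = algebraMap (E₁ k κ h) _ (pi k κ h ^ (Fintype.card k - 1) *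
      (x : E₁ k κ h) ^ Fintype.card k) * e) :
    CongrModPi k κ h
      ((Fintype.card k : ℚ) - 1 + Fintype.card k / ((Fintype.card k : ℚ) ^ h - 1)) f g := by
  have hN : 0 < Fintype.card k ^ h - 1 :=
    Nat.sub_pos_of_lt (Nat.one_lt_pow (NeZero.ne h) Fintype.one_lt_card)
  -- As $x^{q^h-1}=-\pi$ has the wrong sign, $x$ is replaced by $\zeta x$, whose power is exactly
  -- $\pi$. The unit $\zeta^{-q}$ is absorbed into the integral factor.
  obtain ⟨ζ, hζ⟩ := IsAlgClosed.exists_pow_nat_eq (-1 : κ) hN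
  have hζ0 : ζ ≠ 0 := by
    rintro rfl
    rw [zero_pow hN.ne'] at hζ
    exact neg_ne_zero.2 one_ne_zero hζ.symm
  let φ : κ →+* E₁ k κ h := (algebraMap (PowerSeries κ) (E₁ k κ h)).comp PowerSeries.C
  have hφ : ∀ a, φ a ∈ integers k κ h := fun a =>
    (integralClosure (PowerSeries κ) (E₁ k κ h)).algebraMap_mem _
  obtain ⟨hnum, hden⟩ := num_den_exponent (h := h) (Fintype.one_lt_card (α := k)) rfl
  refine ⟨hf, hg, pi k κ h ^ (Fintype.card k - 1) * (φ ζ * x) ^ Fintype.card k, ?_,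
    algebraMap (E₁ k κ h) _ (φ ζ⁻¹ ^ Fintype.card k) * e,
    mul_mem (algebraMap_mem_integralTate (pow_mem (hφ _) _)) he, ?_⟩
  · rw [hnum, hden, zpow_natCast, pow_add, mul_pow, ← pow_mul, ← pow_mul, mul_comm (Fintype.card k),
      pow_mul (φ ζ * _), mul_pow (φ ζ), torsion_pow_sub_one hx, ← map_pow, hζ, map_neg, map_one,
      neg_mul_neg, one_mul]
  · rw [hfg, Algebra.smul_def, ← mul_assoc, ← map_mul]
    congr 2
    have : φ ζ * φ ζ⁻¹ = 1 := by rw [← map_mul, mul_inv_cancel₀ hζ0, map_one]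
    rw [mul_assoc, ← mul_pow, mul_right_comm, this, one_mul]

end Exponent

end LubinTate

end

theorem proposition4p1 {k κ : Type*} [Field k] [Fintype k] [Field κ] [Algebra k κ]
    [IsAlgClosure k κ] (h : ℕ) (hh : 1 ≤ h) :
    ∃ σ : Module.Basis (Fin h) k (torsion k κ h) →
        (PreimageRing k κ h →ₐ[TateAlgebra k κ h (h - 1)] TateAlgebra k κ h (h - 1)),
      Function.Bijective (fun (f : PreimageRing k κ h) x => σ x f) ∧
      ∀ x : Module.Basis (Fin h) k (torsion k κ h),
        (∃! m, m ∈ polydisc (σ x) ∧ IsAboveSpecial m) ∧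
        (∀ m ∈ polydisc (σ x), IsAboveSpecial m → HasCoordinates m (fun r => (x r : E₁ k κ h))) ∧
        ∀ r : Fin h,
          CongrModPi k κ h
            ((Fintype.card k : ℚ) - 1 + Fintype.card k / ((Fintype.card k : ℚ) ^ h - 1))
            (σ x (coordX k κ r))
            ((-1) ^ (h - 1) * (sectionMatrix k κ h (x r : E₁ k κ h)).det) := by
  have : NeZero h := ⟨by omega⟩
  have : IsAlgClosed κ := IsAlgClosure.isAlgClosed k
  refine ⟨polydiscHom, polydiscHom_bijective, fun x => ⟨?_, ?_, fun r => ?_⟩⟩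
  · exact ⟨canonicalPoint x, ⟨canonicalPoint_mem_polydisc x, isAboveSpecial_canonicalPoint x⟩,
      fun m hm => eq_canonicalPoint hm.1 hm.2⟩
  · intro m hm hm'
    rw [eq_canonicalPoint hm hm']
    exact hasCoordinates_canonicalPoint x
  · have hx : (x r : E₁ k κ h) ≠ 0 := fun h0 => x.ne_zero r (Subtype.ext h0)
    obtain ⟨hf, hg, e, he, hfg⟩ := exists_torsionLift_sub_det_eq_mul hx
    rw [polydiscHom_coordX]
    exact congrModPi_of_sub_eq_mul hx hf hg he hfg
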